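/- Consider $n$ qubits and a Lindbladian $\mathcal L=\mathcal H+\mathcal D$ with $\mathcal H(\rho)=-i[H,\rho]$ and $\mathcal D(\rho)=\sum_{\mu=1}^m\bigl(L_\mu\rho L_\mu^\dagger-\tfrac12\{L_\mu^\dagger L_\mu,\rho\}\bigr)$, where the Hermitian operator $H=\sum_{k=0}^{s-1}\beta_{0k}V_{0k}$ and the operators $L_\mu=\sum_{k=0}^{s-1}\beta_{\mu k}V_{\mu k}$ are given by expansions with $\beta_{\mu k}\ge 0$ and $V_{\mu k}$ an $n$-fold tensor product of Pauli operators $I,X,Y,Z$ times an arbitrary phase. Put $\|\mathcal L\|_{pauli}=\sum_k\beta_{0k}+\sum_{\mu=1}^m\bigl(\sum_k\beta_{\mu k}\bigr)^2$, and let $\|\Phi\|_\diamond=\max_{\|X\|_1=1}\|(\mathcal I\otimes\Phi)(X)\|_1$ be the diamond norm, with $\mathcal I$ the identity map on operators on a second copy of the space. A stochastically simulatable channel is a map $\mathcal N(\rho)=q\sum_i\lambda_iU_i\rho U_i^\dagger+(1-q)\operatorname{Tr}(\rho)\rho_f$ (a finite sum) with $U_i$ unitary, $\rho_f$ a state, $0\le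 q\le1$, $\lambda_i\ge0$, $\sum_i\lambda_i=1$. Its oracles are the state preparation $\mathcal A^{(0)}(\rho)=\operatorname{Tr}(\rho)\rho_f$, sampled with probability $1-q$, and the unitary channels $\mathcal A^{(i)}(\rho)=U_i\rho U_i^\dagger$, sampled with probability $q\lambda_i$. A Hamiltonian simulation subroutine with $a$ ancilla qubits is a completely positive trace-preserving map $W$ on ancillas and system; the ancillas are reset to $|0\cdots0\rangle$ before each run. It implements on the system the map $\mathcal K(\rho)=\operatorname{Tr}_{anc}W(|0\cdots0\rangle\langle0\cdots0|\otimes\rho)$. There is a universal constant $C>0$ such that for all $n,m,s$, all such $\mathcal L$, and all $c_0\ge0$, $T\ge0$, $\epsilon>0$ there is an integer $r_0\ge1$ with $$r_0\le\max\Bigl(1,\;C\sqrt{\tfrac{1+6c_0}{\epsilon}}\,\bigl(\|\mathcal L\|_{pauli}T\bigr)^{3/2}\Bigr)$$ for which the following holds for every integer $r\ge r_0$, with $\delta t=T/r$. Let $\mathcal N_{\delta t}$ be a stochastically simulatable channel with $\|e^{\delta t\mathcal D}-\mathcal N_{\delta t}\|_\diamond\le c_0(\|\mathcal D\|_\diamond\delta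 t)^3$, and let $\mathcal K_{\delta t}$ be implemented by a Hamiltonian simulation subroutine, with any number $a$ of ancilla qubits, such that $\|e^{\frac{\delta t}{2}\mathcal H}-\mathcal K_{\delta t}\|_\diamond\le\epsilon/(4r)$. Consider the algorithm on a register of the $n$ system qubits and these $a$ ancilla qubits only, which repeats $r$ times the gadget: run the Hamiltonian simulation subroutine, sample $i$ independently and apply the oracle $\mathcal A^{(i)}_{\delta t}$ to the system qubits, run the Hamiltonian simulation subroutine. Each of its runs makes exactly $r$ oracle calls and $2r$ calls to the subroutine, and the map $\mathcal M$ that it implements on the system, in expectation over the samples, satisfies $\|e^{T\mathcal L}-\mathcal M\|_\diamond\le\epsilon$. -/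

import Mathlib

open scoped BigOperators ComplexOrder

noncomputable section

/-! ### Operators, superoperators, trace norm and diamond norm -/

/-- Basis labels of the Hilbert space of `n` qubits. -/
abbrev Qubits (n : ℕ) : Type := Fin n → Fin 2

/-- Linear maps on the operators of the Hilbert space with orthonormal basis `d`. -/
abbrev SuperOp (d : Type) : Type := Matrix d d ℂ →ₗ[ℂ] Matrix d d ℂ

/-- The trace norm `Tr √(X† X)`, i.e. the sum of the singular values of `X`. -/
def traceNorm {d : Type} [Fintype d] [DecidableEq d] (X : Matrix d d ℂ) : ℝ :=
  ∑ i, Real.sqrt ((Matrix.isHermitian_conjTranspose_mul_self X).eigenvalues i)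

/-- The map `I ⊗ Φ` on the operators of `ℂ^e ⊗ ℂ^d`: it applies `Φ` to each block. -/
def ampliate (e : Type) {d : Type} (Φ : SuperOp d) : SuperOp (e × d) where
  toFun X := Matrix.of fun p q => Φ (X.submatrix (Prod.mk p.1) (Prod.mk q.1)) p.2 q.2
  map_add' X Y := by
    ext p q
    simp [Matrix.submatrix_add]
  map_smul' c X := by
    ext p q
    simp [Matrix.submatrix_smul]

/-- The diamond norm: the supremum of `‖(I ⊗ Φ)(X)‖₁` over the operators `X` of trace norm one
on two copies of the space. -/
def diamondNorm {d : Type} [Fintype d] [DecidableEq d] (Φ : SuperOp d) : ℝ :=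
  sSup {x : ℝ | ∃ X : Matrix (d × d) (d × d) ℂ,
    traceNorm X = 1 ∧ x = traceNorm (ampliate d Φ X)}

/-- The exponential `e^Φ` of a superoperator, computed as the exponential of its matrix in the
basis of matrix units. -/
def superExp {d : Type} [Fintype d] [DecidableEq d] (Φ : SuperOp d) : SuperOp d :=
  (LinearMap.toMatrixAlgEquiv (Matrix.stdBasis ℂ d d)).symm
    (NormedSpace.exp (LinearMap.toMatrixAlgEquiv (Matrix.stdBasis ℂ d d) Φ))

/-- Quantum channels: completely positive, trace-preserving maps. -/
def IsChannel {d : Type} [Fintype d] (Φ : SuperOp d) : Prop :=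
  (∀ (k : ℕ) (X : Matrix (Fin k × d) (Fin k × d) ℂ),
      X.PosSemidef → (ampliate (Fin k) Φ X).PosSemidef) ∧
    ∀ X : Matrix d d ℂ, (Φ X).trace = X.trace

/-- The unitary (or general) conjugation `ρ ↦ A ρ A†`. -/
def conjMap {d : Type} [Fintype d] (A : Matrix d d ℂ) : SuperOp d where
  toFun ρ := A * ρ * A.conjTranspose
  map_add' X Y := by rw [Matrix.mul_add, Matrix.add_mul]
  map_smul' c X := by simp

/-- The linear map that replaces the state of the system by `τ`: `ρ ↦ Tr(ρ) τ`. -/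
def prepareMap {d : Type} [Fintype d] (τ : Matrix d d ℂ) : SuperOp d where
  toFun ρ := ρ.trace • τ
  map_add' X Y := by rw [Matrix.trace_add, add_smul]
  map_smul' c X := by simp [mul_smul]

/-! ### Lindbladians with a Pauli expansion -/

/-- The one-qubit Pauli operators `I`, `X`, `Y`, `Z`. -/
def pauli : Fin 4 → Matrix (Fin 2) (Fin 2) ℂ :=
  ![!![1, 0; 0, 1], !![0, 1; 1, 0], !![0, -Complex.I; Complex.I, 0], !![1, 0; 0, -1]]

/-- The tensor product of `n` one-qubit Pauli operators. -/
def pauliString {n : ℕ} (P : Fin n → Fin 4) : Matrix (Qubits n) (Qubits n) ℂ :=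
  Matrix.of fun x y => ∏ j, pauli (P j) (x j) (y j)

/-- A weighted sum `∑ₖ βₖ Vₖ` of `s` Pauli strings with arbitrary phases, `βₖ ≥ 0`. Zero weights
are allowed, so that expansions of different lengths can share the same `s`. -/
structure PauliSum (n s : ℕ) where
  weight : Fin s → ℝ
  weight_nonneg : ∀ k, 0 ≤ weight k
  phase : Fin s → ℂ
  phase_norm : ∀ k, ‖phase k‖ = 1
  string : Fin s → Fin n → Fin 4

/-- The operator `∑ₖ βₖ Vₖ`. -/
def PauliSum.op {n s : ℕ} (A : PauliSum n s) : Matrix (Qubits n) (Qubits n) ℂ :=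
  ∑ k, ((A.weight k : ℂ) * A.phase k) • pauliString (A.string k)

/-- A Lindbladian on `n` qubits, given by Pauli expansions of its Hamiltonian and of its `m` jump
operators. -/
structure PauliLindbladian (n m s : ℕ) where
  ham : PauliSum n s
  ham_hermitian : ham.op.IsHermitian
  jump : Fin m → PauliSum n s

namespace PauliLindbladian

/-- The generator `ρ ↦ -i [H, ρ]` of the Hamiltonian evolution. -/
def hamiltonianPart {n m s : ℕ} (L : PauliLindbladian n m s) : SuperOp (Qubits n) where
  toFun ρ := (-Complex.I) • (L.ham.op * ρ - ρ * L.ham.op)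
  map_add' X Y := by rw [← smul_add, Matrix.mul_add, Matrix.add_mul]; congr 1; abel
  map_smul' c X := by
    simp only [Matrix.mul_smul, Matrix.smul_mul, ← smul_sub, RingHom.id_apply]
    rw [smul_comm]

/-- The operator `L†L` for the jump operator number `μ`. -/
def jumpSq {n m s : ℕ} (L : PauliLindbladian n m s) (μ : Fin m) :
    Matrix (Qubits n) (Qubits n) ℂ :=
  (L.jump μ).op.conjTranspose * (L.jump μ).op

/-- The dissipator `ρ ↦ ∑_μ (L_μ ρ L_μ† - ½ {L_μ† L_μ, ρ})`. -/
def dissipator {n m s : ℕ} (L : PauliLindbladian n m s) : SuperOp (Qubits n) where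
  toFun ρ := ∑ μ, ((L.jump μ).op * ρ * (L.jump μ).op.conjTranspose
    - (1 / 2 : ℂ) • (L.jumpSq μ * ρ + ρ * L.jumpSq μ))
  map_add' X Y := by
    rw [← Finset.sum_add_distrib]
    refine Finset.sum_congr rfl fun μ _ => ?_
    simp only [Matrix.mul_add, Matrix.add_mul, smul_add]
    abel
  map_smul' c X := by
    rw [RingHom.id_apply, Finset.smul_sum]
    refine Finset.sum_congr rfl fun μ _ => ?_
    simp only [Matrix.mul_smul, Matrix.smul_mul, smul_sub, smul_add]
    rw [smul_comm c, smul_comm c]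

/-- The Lindbladian itself, Hamiltonian part plus dissipator. -/
def generator {n m s : ℕ} (L : PauliLindbladian n m s) : SuperOp (Qubits n) :=
  L.hamiltonianPart + L.dissipator

/-- The Pauli norm `∑ₖ β₀ₖ + ∑_μ (∑ₖ β_μₖ)²` of the expansion. -/
def pauliNorm {n m s : ℕ} (L : PauliLindbladian n m s) : ℝ :=
  ∑ k, L.ham.weight k + ∑ μ, (∑ k, (L.jump μ).weight k) ^ 2

end PauliLindbladian

/-! ### Stochastically simulatable channels -/

/-- The data of a stochastically simulatable channel
`ρ ↦ q ∑ᵢ λᵢ Uᵢ ρ Uᵢ† + (1 - q) ρ_f` on `n` qubits. -/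
structure StochasticChannel (n : ℕ) where
  terms : ℕ
  q : ℝ
  q_nonneg : 0 ≤ q
  q_le_one : q ≤ 1
  lam : Fin terms → ℝ
  lam_nonneg : ∀ i, 0 ≤ lam i
  lam_sum : ∑ i, lam i = 1
  U : Fin terms → Matrix (Qubits n) (Qubits n) ℂ
  U_unitary : ∀ i, U i ∈ Matrix.unitaryGroup (Qubits n) ℂ
  state : Matrix (Qubits n) (Qubits n) ℂ
  state_posSemidef : state.PosSemidef
  state_trace : state.trace = 1

namespace StochasticChannel

/-- The channel `ρ ↦ q ∑ᵢ λᵢ Uᵢ ρ Uᵢ† + (1 - q) Tr(ρ) ρ_f`. -/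
def toMap {n : ℕ} (N : StochasticChannel n) : SuperOp (Qubits n) :=
  N.q • (∑ i, N.lam i • conjMap (N.U i)) + (1 - N.q) • prepareMap N.state

/-- Labels of the operations to be sampled: `none` is the state preparation, `some i` the `i`-th
unitary. -/
abbrev Label {n : ℕ} (N : StochasticChannel n) : Type := Option (Fin N.terms)

/-- The sampled operations (the oracles). -/
def operation {n : ℕ} (N : StochasticChannel n) : N.Label → SuperOp (Qubits n)
  | none => prepareMap N.state
  | some i => conjMap (N.U i)

/-- The probabilities with which the operations are sampled. -/
def prob {n : ℕ} (N : StochasticChannel n) : N.Label → ℝ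
  | none => 1 - N.q
  | some i => N.q * N.lam i

theorem prob_nonneg {n : ℕ} (N : StochasticChannel n) (i : N.Label) : 0 ≤ N.prob i := by
  cases i with
  | none => exact sub_nonneg.mpr N.q_le_one
  | some i => exact mul_nonneg N.q_nonneg (N.lam_nonneg i)

theorem prob_sum {n : ℕ} (N : StochasticChannel n) : ∑ i, N.prob i = 1 := by
  rw [Fintype.sum_option]
  simp only [prob]
  rw [← Finset.mul_sum, N.lam_sum]
  ring

end StochasticChannel

/-! ### Circuits over the oracles and a Hamiltonian simulation subroutine

The register consists of the ancilla qubits of the Hamiltonian simulation subroutine (first factor)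
and of the `n` system qubits (second factor), and of nothing else. -/

/-- Appending ancilla qubits in the state `|0…0⟩`: `ρ ↦ |0…0⟩⟨0…0| ⊗ ρ`. -/
def attachAncilla (a : ℕ) {d : Type} :
    Matrix d d ℂ →ₗ[ℂ] Matrix (Qubits a × d) (Qubits a × d) ℂ where
  toFun ρ := Matrix.of fun p q => if p.1 = 0 ∧ q.1 = 0 then ρ p.2 q.2 else 0
  map_add' X Y := by
    ext p q
    by_cases h : p.1 = 0 ∧ q.1 = 0 <;> simp [h]
  map_smul' c X := by
    ext p q
    by_cases h : p.1 = 0 ∧ q.1 = 0 <;> simp [h]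

/-- The partial trace over the ancilla qubits. -/
def discardAncilla (a : ℕ) {d : Type} :
    Matrix (Qubits a × d) (Qubits a × d) ℂ →ₗ[ℂ] Matrix d d ℂ where
  toFun X := Matrix.of fun i j => ∑ x, X (x, i) (x, j)
  map_add' X Y := by
    ext i j
    simp [Finset.sum_add_distrib]
  map_smul' c X := by
    ext i j
    simp [Finset.mul_sum]

/-- A Hamiltonian simulation subroutine on `n` system qubits with `a` ancilla qubits: any quantum
operation on system and ancillas; the ancillas are reset to `|0…0⟩` before it is run. -/
structure HamiltonianSubroutine (n a : ℕ) where
  joint : SuperOp (Qubits a × Qubits n)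
  isChannel : IsChannel joint

/-- The map on the system that the subroutine implements. -/
def HamiltonianSubroutine.toMap {n a : ℕ} (K : HamiltonianSubroutine n a) : SuperOp (Qubits n) :=
  discardAncilla a ∘ₗ K.joint ∘ₗ attachAncilla a

/-- The instructions of a circuit: a call to the Hamiltonian simulation subroutine, or a call to
the oracle with a given label. -/
inductive Instruction (ι : Type) : Type
  | hamiltonian : Instruction ι
  | oracle (i : ι) : Instruction ι

/-- Whether an instruction is an oracle call. -/
def Instruction.isOracle {ι : Type} : Instruction ι → Bool
  | .hamiltonian => false
  | .oracle _ => true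

/-- The number of oracle calls in a circuit. -/
def oracleCalls {ι : Type} (c : List (Instruction ι)) : ℕ := c.countP fun g => g.isOracle

/-- The number of calls to the Hamiltonian simulation subroutine in a circuit. -/
def hamiltonianCalls {ι : Type} (c : List (Instruction ι)) : ℕ := c.countP fun g => !g.isOracle

/-- The action of an instruction on the register. A call to the Hamiltonian simulation subroutine
resets the ancillas and runs the subroutine; an oracle acts on the system qubits alone. -/
def Instruction.action {n a : ℕ} (N : StochasticChannel n) (K : HamiltonianSubroutine n a) :
    Instruction N.Label → SuperOp (Qubits a × Qubits n)
  | .hamiltonian => K.joint ∘ₗ attachAncilla a ∘ₗ discardAncilla a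
  | .oracle i => ampliate (Qubits a) (N.operation i)

/-- The action of a circuit on the register; the head of the list is executed first. -/
def circuitAction {n a : ℕ} (N : StochasticChannel n) (K : HamiltonianSubroutine n a) :
    List (Instruction N.Label) → SuperOp (Qubits a × Qubits n)
  | [] => LinearMap.id
  | g :: c => circuitAction N K c ∘ₗ g.action N K

/-- The map on the system that a circuit implements: the ancillas start in `|0…0⟩` and are
discarded at the end. -/
def circuitMap {n a : ℕ} (N : StochasticChannel n) (K : HamiltonianSubroutine n a)
    (c : List (Instruction N.Label)) : SuperOp (Qubits n) :=
  discardAncilla a ∘ₗ circuitAction N K c ∘ₗ attachAncilla a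

/-- A randomly compiled circuit: a finite probability space of seeds, and a circuit for each
seed. -/
structure RandomCircuit (ι : Type) where
  Seed : Type
  fintypeSeed : Fintype Seed
  prob : Seed → ℝ
  prob_nonneg : ∀ ω, 0 ≤ prob ω
  prob_sum : ∑ ω, prob ω = 1
  circuit : Seed → List (Instruction ι)

/-- The map implemented by a randomly compiled circuit: the expectation over the seeds. -/
def RandomCircuit.toMap {n a : ℕ} {N : StochasticChannel n} (R : RandomCircuit N.Label)
    (K : HamiltonianSubroutine n a) : SuperOp (Qubits n) :=
  letI := R.fintypeSeed
  ∑ ω, R.prob ω • circuitMap N K (R.circuit ω)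

/-- The simulation gadget for the sampled label `i`: the Hamiltonian simulation subroutine, the
sampled operation, and the Hamiltonian simulation subroutine again. -/
def gadget {ι : Type} (i : ι) : List (Instruction ι) :=
  [.hamiltonian, .oracle i, .hamiltonian]

/-- The algorithm: `r` repetitions of the simulation gadget, the labels being sampled independently
with the probabilities of the stochastically simulatable channel. -/
def gadgetAlgorithm {n : ℕ} (N : StochasticChannel n) (r : ℕ) : RandomCircuit N.Label where
  Seed := Fin r → N.Label
  fintypeSeed := inferInstance
  prob ω := ∏ j, N.prob (ω j)
  prob_nonneg ω := Finset.prod_nonneg fun j _ => N.prob_nonneg (ω j)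
  prob_sum := by
    rw [← Fintype.prod_sum (fun (_ : Fin r) (i : N.Label) => N.prob i)]
    simp [N.prob_sum]
  circuit ω := (List.ofFn ω).flatMap gadget

end

/-! ### Exponentials, contractions and the symmetric Trotter step in a Banach algebra. -/

section BanachAlgebra

/-! The map `Φ ↦ I ⊗ Φ` embeds superoperators as an algebra into the bounded operators for the trace
norm, and the diamond norm becomes the operator norm (`diamondNorm_eq_norm_amplify`). The analysis
then takes place in a Banach algebra. Independence of the samples makes the algorithm implement
exactly `(K N K) ^ r` (`toMap_gadgetAlgorithm`), while `e^{TL}` is the `r`-th power of `e^{δL}` with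
`δ = T/r`. Powers of contractions differ by at most `r` times the difference of the bases, so one
step has to be controlled.

With `Λ` the Pauli norm, both parts of the generator have norm at most `2Λ`. The symmetric product
`e^{δH/2} e^{δD} e^{δH/2}` agrees with `e^{δL}` to second order, so the Trotter error is `O((Λδ)³)`
(`norm_exp_sub_trotter_le`). Replacing the exact factors by the oracles and the subroutine adds
`c₀(2Λδ)³ + 2·ε/(4r)`. Over `r` steps this is `O((1 + c₀)(ΛT)³/r²) + ε/2`, which the choice of `r₀`
makes at most `ε`.

No exponential of `ΛT` is lost because every factor is a contraction. For channels this follows from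
duality of the trace norm with unitaries and positive 2×2 block matrices. For the semigroups, an
Euler step differs from a completely positive map by a conjugation of order `t²`
(`norm_exp_amplify_le_one`), and `e^z = (e^{z/k})^k` removes the second-order defect as `k → ∞`. -/

theorem norm_pow_le_one_of_le {𝔸 : Type*} [NormedRing 𝔸] [NormOneClass 𝔸] {x : 𝔸}
    (hx : ‖x‖ ≤ 1) (r : ℕ) : ‖x ^ r‖ ≤ 1 :=
  (norm_pow_le x r).trans (pow_le_one₀ (norm_nonneg x) hx)

theorem norm_pow_sub_pow_le_of_contraction {𝔸 : Type*} [NormedRing 𝔸] [NormOneClass 𝔸]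
    {x y : 𝔸} (hx : ‖x‖ ≤ 1) (hy : ‖y‖ ≤ 1) (r : ℕ) :
    ‖x ^ r - y ^ r‖ ≤ r * ‖x - y‖ := by
  induction r with
  | zero => simp
  | succ r ih =>
    have e : x ^ (r + 1) - y ^ (r + 1) = x ^ r * (x - y) + (x ^ r - y ^ r) * y := by
      rw [pow_succ, pow_succ]; noncomm_ring
    rw [e]
    have h1 : ‖x ^ r * (x - y)‖ ≤ 1 * ‖x - y‖ :=
      (norm_mul_le _ _).trans (by gcongr; exact norm_pow_le_one_of_le hx r)
    have h2 : ‖(x ^ r - y ^ r) * y‖ ≤ ‖x ^ r - y ^ r‖ * 1 :=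
      (norm_mul_le _ _).trans (by gcongr)
    have h3 := norm_add_le (x ^ r * (x - y)) ((x ^ r - y ^ r) * y)
    push_cast
    linarith

/-- Telescoping, one factor at a time. Only the primed left factor, the unprimed right factor and
both middle factors need bounds. -/
theorem norm_mul_mul_sub_le {𝔸 : Type*} [NormedRing 𝔸]
    {a b c a' b' c' : 𝔸} {A B C : ℝ} (ha : ‖a'‖ ≤ A) (hb : ‖b‖ ≤ B)
    (hb' : ‖b'‖ ≤ B) (hc : ‖c‖ ≤ C) :
    ‖a * b * c - a' * b' * c'‖ ≤ B * C * ‖a - a'‖ + A * C * ‖b - b'‖ + A * B * ‖c - c'‖ := by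
  have hA := (norm_nonneg _).trans ha
  have hB := (norm_nonneg _).trans hb
  have e : a * b * c - a' * b' * c'
      = (a - a') * b * c + a' * (b - b') * c + a' * b' * (c - c') := by noncomm_ring
  rw [e]
  refine norm_add₃_le.trans ?_
  have h1 : ‖(a - a') * b * c‖ ≤ ‖a - a'‖ * B * C :=
    norm_mul₃_le.trans (by gcongr)
  have h2 : ‖a' * (b - b') * c‖ ≤ A * ‖b - b'‖ * C :=
    norm_mul₃_le.trans (by gcongr)
  have h3 : ‖a' * b' * (c - c')‖ ≤ A * B * ‖c - c'‖ :=
    norm_mul₃_le.trans (by gcongr)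
  linarith

variable {𝔸 : Type*} [NormedRing 𝔸] [NormOneClass 𝔸] [NormedAlgebra ℂ 𝔸] [CompleteSpace 𝔸]

/-- The tail of the series is dominated termwise by the tail of the real exponential at `‖z‖`, so
real Taylor bounds carry over. -/
theorem norm_exp_sub_partialSum_le (z : 𝔸) (k : ℕ) :
    ‖NormedSpace.exp z - ∑ i ∈ Finset.range k, ((i.factorial : ℂ)⁻¹) • z ^ i‖
      ≤ Real.exp ‖z‖ - ∑ i ∈ Finset.range k, ‖z‖ ^ i / i.factorial := by
  have h1 := (hasSum_nat_add_iff' k).mpr (NormedSpace.exp_series_hasSum_exp' (𝕂 := ℂ) z)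
  have h2 := (hasSum_nat_add_iff' k).mpr (NormedSpace.expSeries_div_hasSum_exp ‖z‖)
  rw [← Real.exp_eq_exp_ℝ] at h2
  rw [← h1.tsum_eq]
  refine tsum_of_norm_bounded h2 fun i => ?_
  rw [norm_smul, norm_inv, Complex.norm_natCast, div_eq_inv_mul]
  gcongr
  exact norm_pow_le z _

theorem norm_exp_sub_one_sub_le {z : 𝔸} (hz : ‖z‖ ≤ 1) :
    ‖NormedSpace.exp z - (1 + z)‖ ≤ ‖z‖ ^ 2 := by
  have h := norm_exp_sub_partialSum_le z 2
  have h2 := Real.exp_bound (x := ‖z‖) (by rwa [abs_norm]) (n := 2) (by norm_num)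
  rw [abs_norm] at h2
  have h3 := (le_abs_self _).trans h2
  simp only [Finset.sum_range_succ, Finset.sum_range_zero] at h h3
  norm_num [Nat.factorial] at h h3
  nlinarith [sq_nonneg ‖z‖]

theorem norm_exp_sub_quadratic_le {z : 𝔸} (hz : ‖z‖ ≤ 1) :
    ‖NormedSpace.exp z - (1 + z + (1 / 2 : ℂ) • z ^ 2)‖ ≤ ‖z‖ ^ 3 * (2 / 9) := by
  have h := norm_exp_sub_partialSum_le z 3
  have h2 := Real.exp_bound (x := ‖z‖) (by rwa [abs_norm]) (n := 3) (by norm_num)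
  rw [abs_norm] at h2
  have h3 := (le_abs_self _).trans h2
  simp only [Finset.sum_range_succ, Finset.sum_range_zero] at h h3
  norm_num [Nat.factorial] at h h3 ⊢
  linarith

/-- A generator whose Euler steps are contractions up to second order generates contractions. -/
theorem norm_exp_le_one_of_norm_one_add_le {z : 𝔸} {c : ℝ}
    (h : ∀ t : ℝ, 0 ≤ t → t ≤ 1 → ‖1 + (t : ℂ) • z‖ ≤ 1 + c * t ^ 2) :
    ‖NormedSpace.exp z‖ ≤ 1 := by
  let : NormedAlgebra ℚ 𝔸 := NormedAlgebra.restrictScalars ℚ ℂ 𝔸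
  -- `b` collects the two second-order errors: the defect of the Euler step and the Taylor remainder
  -- of `e^{z/k}`. Then `‖e^z‖ ≤ (1 + b/k²)^k ≤ e^{b/k}`.
  set b : ℝ := |c| + ‖z‖ ^ 2
  have hb : 0 ≤ b := by positivity
  have key : ∀ᶠ k : ℕ in Filter.atTop, ‖NormedSpace.exp z‖ ≤ Real.exp (b / k) := by
    filter_upwards [Filter.eventually_ge_atTop (max 1 ⌈‖z‖⌉₊)] with k hk
    have hk1 : 1 ≤ k := (le_max_left _ _).trans hk
    have hkz : ‖z‖ ≤ k := (Nat.le_ceil _).trans (by exact_mod_cast (le_max_right _ _).trans hk)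
    have hk0 : (0 : ℝ) < k := by exact_mod_cast hk1
    have hz : NormedSpace.exp z = NormedSpace.exp (((1 / k : ℝ) : ℂ) • z) ^ k := by
      rw [← NormedSpace.exp_nsmul, ← Nat.cast_smul_eq_nsmul ℂ, smul_smul]
      have : (k : ℂ) * ((1 / k : ℝ) : ℂ) = 1 := by
        push_cast
        field_simp
      rw [this, one_smul]
    have hn : ‖((1 / k : ℝ) : ℂ) • z‖ = ‖z‖ / k := by
      rw [norm_smul, Complex.norm_real, Real.norm_of_nonneg (by positivity)]; ring
    have h1 := norm_exp_sub_one_sub_le (z := ((1 / k : ℝ) : ℂ) • z)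
      (by rw [hn]; exact (div_le_one hk0).mpr hkz)
    have h2 := h (1 / k) (by positivity) ((div_le_one hk0).mpr (by exact_mod_cast hk1))
    have h3 : ‖NormedSpace.exp (((1 / k : ℝ) : ℂ) • z)‖ ≤ 1 + b / k ^ 2 := by
      have := norm_le_norm_add_norm_sub' (NormedSpace.exp (((1 / k : ℝ) : ℂ) • z))
        (1 + ((1 / k : ℝ) : ℂ) • z)
      have hc : c * (1 / (k : ℝ)) ^ 2 ≤ |c| * (1 / (k : ℝ)) ^ 2 := by
        gcongr; exact le_abs_self c
      rw [hn] at h1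
      have e : b / (k : ℝ) ^ 2 = |c| * (1 / (k : ℝ)) ^ 2 + (‖z‖ / k) ^ 2 := by
        simp only [b]; field_simp
      linarith
    rw [hz]
    calc _ ≤ ‖NormedSpace.exp (((1 / k : ℝ) : ℂ) • z)‖ ^ k := norm_pow_le _ _
      _ ≤ (1 + b / k ^ 2) ^ k := by gcongr
      _ ≤ Real.exp (b / k ^ 2) ^ k := by
        gcongr; rw [add_comm]; exact Real.add_one_le_exp _
      _ = Real.exp (b / k) := by
        rw [← Real.exp_nat_mul]; congr 1; field_simp
  have lim : Filter.Tendsto (fun k : ℕ => Real.exp (b / k)) Filter.atTop (nhds 1) := by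
    rw [← Real.exp_zero]
    exact (Real.continuous_exp.tendsto 0).comp (tendsto_const_div_atTop_nhds_zero_nat b)
  exact ge_of_tendsto lim key

/-- The error of a second-order Trotter step for contraction semigroups. -/
theorem norm_exp_sub_trotter_le {x y : 𝔸} {u : ℝ} (hx : ‖x‖ ≤ u) (hy : ‖y‖ ≤ u)
    (hex : ‖NormedSpace.exp x‖ ≤ 1) (hey : ‖NormedSpace.exp y‖ ≤ 1)
    (hexy : ‖NormedSpace.exp ((2 : ℂ) • x + y)‖ ≤ 1) :
    ‖NormedSpace.exp ((2 : ℂ) • x + y)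
      - NormedSpace.exp x * NormedSpace.exp y * NormedSpace.exp x‖ ≤ 54 * u ^ 3 := by
  have hu : 0 ≤ u := (norm_nonneg _).trans hx
  -- For large `u` contractivity alone suffices: the difference is at most `2 ≤ 2(3u)³`. This case
  -- fixes the constant 54; the Taylor estimate for small `u` needs less.
  by_cases h3 : 1 < 3 * u
  · have h1 : ‖NormedSpace.exp x * NormedSpace.exp y * NormedSpace.exp x‖ ≤ 1 * 1 * 1 :=
      norm_mul₃_le.trans (by gcongr)
    have h2 := norm_sub_le (NormedSpace.exp ((2 : ℂ) • x + y))
      (NormedSpace.exp x * NormedSpace.exp y * NormedSpace.exp x)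
    have h4 : (1 : ℝ) ≤ (3 * u) ^ 3 := one_le_pow₀ h3.le
    nlinarith
  push Not at h3
  have hu1 : u ≤ 1 / 3 := by linarith
  have hz : ‖(2 : ℂ) • x + y‖ ≤ 3 * u := by
    refine (norm_add_le _ _).trans ?_
    rw [norm_smul]
    norm_num
    linarith
  set p : 𝔸 := x + (1 / 2 : ℂ) • x ^ 2 with hp
  set q : 𝔸 := y + (1 / 2 : ℂ) • y ^ 2 with hq
  have quad : ∀ w : 𝔸, ‖w‖ ≤ u → ‖(1 / 2 : ℂ) • w ^ 2‖ ≤ u ^ 2 / 2 := fun w hw => by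
    rw [norm_smul]
    have := (norm_pow_le w 2).trans (pow_le_pow_left₀ (norm_nonneg _) hw 2)
    norm_num
    linarith
  have lin : ∀ w : 𝔸, ‖w‖ ≤ u → ‖w + (1 / 2 : ℂ) • w ^ 2‖ ≤ 2 * u := fun w hw => by
    have := norm_add_le w ((1 / 2 : ℂ) • w ^ 2)
    have := quad w hw
    nlinarith
  have hpn : ‖p‖ ≤ 2 * u := lin x hx
  have hqn : ‖q‖ ≤ 2 * u := lin y hy
  have one_add : ∀ w : 𝔸, ‖w‖ ≤ 2 * u → ‖1 + w‖ ≤ 2 := fun w hw => by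
    have := norm_add_le 1 w
    rw [norm_one] at this
    linarith
  have rem : ∀ w : 𝔸, ‖w‖ ≤ u →
      ‖NormedSpace.exp w - (1 + (w + (1 / 2 : ℂ) • w ^ 2))‖ ≤ u ^ 3 * (2 / 9) := fun w hw => by
    rw [← add_assoc]
    exact (norm_exp_sub_quadratic_le (hw.trans (by linarith))).trans (by gcongr)
  have hrz := norm_exp_sub_quadratic_le (hz.trans (by linarith))
  have hrz' : ‖(2 : ℂ) • x + y‖ ^ 3 ≤ (3 * u) ^ 3 := by gcongr
  have hprod := norm_mul_mul_sub_le (a := NormedSpace.exp x) (b := NormedSpace.exp y)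
    (c := NormedSpace.exp x) (c' := 1 + p) (one_add p hpn) (hey.trans one_le_two)
    (one_add q hqn) hex
  have hrx := rem x hx
  have hry := rem y hy
  -- The symmetric order of the factors cancels all terms of degree at most two; only products of
  -- degree at least three remain.
  have poly : (1 + p) * (1 + q) * (1 + p)
      - (1 + ((2 : ℂ) • x + y) + (1 / 2 : ℂ) • ((2 : ℂ) • x + y) ^ 2)
      = (x * ((1 / 2 : ℂ) • y ^ 2) + (1 / 2 : ℂ) • x ^ 2 * q)
        + (y * ((1 / 2 : ℂ) • x ^ 2) + (1 / 2 : ℂ) • y ^ 2 * p)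
        + (x * ((1 / 2 : ℂ) • x ^ 2) + (1 / 2 : ℂ) • x ^ 2 * p) + p * q * p := by
    have e2 : (2 : ℂ) • x = x + x := two_smul ℂ x
    have e4 : (1 / 2 : ℂ) • ((x + x + y) * (x + x + y))
        = x * x + x * x + x * y + y * x + (1 / 2 : ℂ) • (y * y) := by
      have : (x + x + y) * (x + x + y)
          = (2 : ℂ) • (x * x + x * x + x * y + y * x) + y * y := by
        rw [two_smul]; noncomm_ring
      rw [this, smul_add, smul_smul]
      norm_num
    have e5 : x * x = (1 / 2 : ℂ) • (x * x) + (1 / 2 : ℂ) • (x * x) := by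
      rw [← add_smul]; norm_num
    rw [hp, hq, e2, sq, sq, sq, e4]
    -- With the halved squares as atoms and `x * x = X + X`, the identity has no fractional
    -- coefficients left.
    generalize hX : (1 / 2 : ℂ) • (x * x) = X at *
    generalize (1 / 2 : ℂ) • (y * y) = Y
    have e6 : x * x + x * x = x * x + X + X := by rw [add_assoc, ← e5]
    rw [e6]
    noncomm_ring
  have b2 : ∀ v w z' : 𝔸, ‖v‖ ≤ u → ‖w‖ ≤ u → ‖z'‖ ≤ 2 * u →
      ‖v * ((1 / 2 : ℂ) • w ^ 2) + (1 / 2 : ℂ) • v ^ 2 * z'‖ ≤ 3 / 2 * u ^ 3 :=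
    fun v w z' hv hw hz' => by
      have h1 : ‖v * ((1 / 2 : ℂ) • w ^ 2)‖ ≤ u * (u ^ 2 / 2) :=
        (norm_mul_le _ _).trans (by gcongr; exact quad w hw)
      have h2 : ‖(1 / 2 : ℂ) • v ^ 2 * z'‖ ≤ (u ^ 2 / 2) * (2 * u) :=
        (norm_mul_le _ _).trans (by gcongr; exact quad v hv)
      have := norm_add_le (v * ((1 / 2 : ℂ) • w ^ 2)) ((1 / 2 : ℂ) • v ^ 2 * z')
      nlinarith
  have hpqp : ‖p * q * p‖ ≤ 2 * u * (2 * u) * (2 * u) := norm_mul₃_le.trans (by gcongr)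
  have hpoly : ‖(1 + p) * (1 + q) * (1 + p)
      - (1 + ((2 : ℂ) • x + y) + (1 / 2 : ℂ) • ((2 : ℂ) • x + y) ^ 2)‖ ≤ 25 / 2 * u ^ 3 := by
    rw [poly]
    refine (norm_add_le _ _).trans ?_
    have h1 := norm_add₃_le (a := x * ((1 / 2 : ℂ) • y ^ 2) + (1 / 2 : ℂ) • x ^ 2 * q)
      (b := y * ((1 / 2 : ℂ) • x ^ 2) + (1 / 2 : ℂ) • y ^ 2 * p)
      (c := x * ((1 / 2 : ℂ) • x ^ 2) + (1 / 2 : ℂ) • x ^ 2 * p)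
    have h2 := b2 x y q hx hy hqn
    have h3 := b2 y x p hy hx hpn
    have h4 := b2 x x p hx hx hpn
    nlinarith
  have tri := norm_sub_le_norm_sub_add_norm_sub (NormedSpace.exp ((2 : ℂ) • x + y))
    (1 + ((2 : ℂ) • x + y) + (1 / 2 : ℂ) • ((2 : ℂ) • x + y) ^ 2)
    (NormedSpace.exp x * NormedSpace.exp y * NormedSpace.exp x)
  have tri2 := norm_sub_le_norm_sub_add_norm_sub
    (1 + ((2 : ℂ) • x + y) + (1 / 2 : ℂ) • ((2 : ℂ) • x + y) ^ 2)
    ((1 + p) * (1 + q) * (1 + p))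
    (NormedSpace.exp x * NormedSpace.exp y * NormedSpace.exp x)
  rw [norm_sub_rev _ ((1 + p) * (1 + q) * (1 + p)),
    norm_sub_rev ((1 + p) * (1 + q) * (1 + p)) (NormedSpace.exp x * _ * _)] at tri2
  have hu3 : 0 ≤ u ^ 3 := by positivity
  nlinarith

end BanachAlgebra

/-! ### Singular values, duality of the trace norm, and positive block matrices. -/

section TraceNorm

open Matrix

theorem traceNorm_nonneg {d : Type} [Fintype d] [DecidableEq d] (X : Matrix d d ℂ) :
    0 ≤ traceNorm X :=
  Finset.sum_nonneg fun _ _ => Real.sqrt_nonneg _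

/-- The singular value decomposition of a square matrix. -/
theorem exists_singularValueDecomposition {d : Type} [Fintype d] [DecidableEq d]
    (X : Matrix d d ℂ) :
    ∃ U ∈ unitaryGroup d ℂ, ∃ V ∈ unitaryGroup d ℂ, ∃ σ : d → ℝ,
      (∀ i, 0 ≤ σ i) ∧ ∑ i, σ i = traceNorm X ∧
        X = U * diagonal (fun i => (σ i : ℂ)) * Vᴴ := by
  set hH := isHermitian_conjTranspose_mul_self X
  set v := hH.eigenvectorBasis
  set σ : d → ℝ := fun i => Real.sqrt (hH.eigenvalues i)
  have hpos : ∀ i, 0 ≤ hH.eigenvalues i :=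
    (posSemidef_conjTranspose_mul_self X).eigenvalues_nonneg
  have hσ : ∀ i, σ i ^ 2 = hH.eigenvalues i := fun i => Real.sq_sqrt (hpos i)
  -- The images under `X` of the eigenvectors of `X†X` are orthogonal with lengths `σ i`.
  -- Normalised, they form the left singular vectors.
  let f : d → EuclideanSpace ℂ d := fun i => WithLp.toLp 2 (X *ᵥ (v i).ofLp)
  have hf : ∀ i j, inner ℂ (f i) (f j) = if i = j then ((σ i ^ 2 : ℝ) : ℂ) else 0 := by
    intro i j
    have h1 : inner ℂ (f i) (f j)
        = inner ℂ (v i) (WithLp.toLp 2 ((Xᴴ * X) *ᵥ (v j).ofLp)) := by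
      simp only [f, EuclideanSpace.inner_eq_star_dotProduct]
      rw [star_mulVec, dotProduct_comm, ← dotProduct_mulVec, mulVec_mulVec, dotProduct_comm]
    rw [h1, hH.mulVec_eigenvectorBasis]
    have h2 : inner ℂ (v i) (WithLp.toLp 2 (hH.eigenvalues j • (v j).ofLp))
        = (hH.eigenvalues j : ℂ) * inner ℂ (v i) (v j) := by
      rw [← inner_smul_right]
      congr 1
    rw [h2, orthonormal_iff_ite.mp v.orthonormal i j, hσ]
    by_cases h : i = j
    · simp [h]
    · simp [h]
  let g : d → EuclideanSpace ℂ d := fun i => ((σ i)⁻¹ : ℂ) • f i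
  have hg : Orthonormal ℂ (({i | σ i ≠ 0} : Set d).domRestrict g) := by
    rw [orthonormal_iff_ite]
    rintro ⟨i, hi⟩ ⟨j, hj⟩
    have hi' : (σ i : ℂ) ≠ 0 := by exact_mod_cast hi
    simp only [Set.domRestrict_apply, g, inner_smul_left, inner_smul_right, hf, Subtype.mk.injEq]
    by_cases h : i = j
    · subst h
      simp only [if_true, map_inv₀, Complex.conj_ofReal]
      push_cast
      field_simp
    · simp [h]
  -- Only the indices with `σ i ≠ 0` give unit vectors; the extension fills in the others
  -- arbitrarily.
  obtain ⟨b, hb⟩ := hg.exists_orthonormalBasis_extension_of_card_eq (by simp)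
  have hXv : ∀ i, f i = (σ i : ℂ) • b i := by
    intro i
    by_cases hi : σ i = 0
    · have : inner ℂ (f i) (f i) = 0 := by rw [hf]; simp [hi]
      rw [inner_self_eq_zero.mp this, hi]
      simp
    · rw [hb i hi]
      have hi' : (σ i : ℂ) ≠ 0 := by exact_mod_cast hi
      simp [g, smul_smul, hi']
  set e := EuclideanSpace.basisFun d ℂ
  have hU := e.toMatrix_orthonormalBasis_mem_unitary b
  have hV := e.toMatrix_orthonormalBasis_mem_unitary v
  refine ⟨_, hU, _, hV, σ, fun i => Real.sqrt_nonneg _, rfl, ?_⟩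
  set U := e.toBasis.toMatrix b
  set V := e.toBasis.toMatrix v
  have hXV : X * V = U * diagonal (fun i => (σ i : ℂ)) := by
    ext i j
    have := congrFun (congrArg WithLp.ofLp (hXv j)) i
    rw [mul_diagonal]
    simp only [f, WithLp.ofLp_smul, Pi.smul_apply, smul_eq_mul] at this
    rw [mul_comm, show U i j = (b j).ofLp i from rfl, ← this]
    rfl
  rw [← hXV, Matrix.mul_assoc, ← star_eq_conjTranspose, (mem_unitaryGroup_iff).mp hV,
    Matrix.mul_one]

theorem exists_polarDecomposition {d : Type} [Fintype d] [DecidableEq d] (X : Matrix d d ℂ) :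
    ∃ U ∈ unitaryGroup d ℂ, ∃ R : Matrix d d ℂ, R.PosSemidef ∧ R.trace = (traceNorm X : ℂ) ∧
      X = U * R := by
  obtain ⟨U, hU, V, hV, σ, hσ, hs, hX⟩ := exists_singularValueDecomposition X
  refine ⟨U * Vᴴ, mul_mem hU (Unitary.star_mem hV), V * diagonal (fun i => (σ i : ℂ)) * Vᴴ,
    ?_, ?_, ?_⟩
  · refine PosSemidef.mul_mul_conjTranspose_same ?_ V
    exact PosSemidef.diagonal fun i => by simpa using hσ i
  · have : Vᴴ * V = 1 := mem_unitaryGroup_iff'.mp hV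
    rw [trace_mul_comm, ← Matrix.mul_assoc, this, Matrix.one_mul, trace_diagonal, ← hs]
    push_cast
    rfl
  · have : Vᴴ * V = 1 := mem_unitaryGroup_iff'.mp hV
    rw [hX]
    calc _ = U * 1 * diagonal (fun i => (σ i : ℂ)) * Vᴴ := by rw [Matrix.mul_one]
      _ = _ := by rw [← this]; simp only [Matrix.mul_assoc]

theorem exists_trace_unitary_mul_eq_traceNorm {d : Type} [Fintype d] [DecidableEq d]
    (X : Matrix d d ℂ) :
    ∃ U ∈ unitaryGroup d ℂ, (U * X).trace = (traceNorm X : ℂ) := by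
  obtain ⟨U, hU, R, -, hR, hX⟩ := exists_polarDecomposition X
  refine ⟨Uᴴ, Unitary.star_mem hU, ?_⟩
  have : Uᴴ * U = 1 := mem_unitaryGroup_iff'.mp hU
  calc (Uᴴ * X).trace = (Uᴴ * (U * R)).trace := by rw [← hX]
    _ = _ := by rw [← Matrix.mul_assoc, this, Matrix.one_mul, hR]

/-- With the polar decomposition `X = U R`, the block matrix is `W R W†` for the column `W = (U;
1)`. Such dominating blocks transfer trace bounds on positive operators to arbitrary ones. -/
theorem exists_posSemidef_fromBlocks {d : Type} [Fintype d] [DecidableEq d] (X : Matrix d d ℂ) :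
    ∃ P Q : Matrix d d ℂ, (fromBlocks P X Xᴴ Q).PosSemidef ∧ P.trace = (traceNorm X : ℂ) ∧
      Q.trace = (traceNorm X : ℂ) := by
  obtain ⟨U, hU, R, hR, hRt, hX⟩ := exists_polarDecomposition X
  have hUU : Uᴴ * U = 1 := mem_unitaryGroup_iff'.mp hU
  refine ⟨U * R * Uᴴ, R, ?_, ?_, hRt⟩
  · have h := hR.mul_mul_conjTranspose_same (fromRows U (1 : Matrix d d ℂ))
    rw [conjTranspose_fromRows_eq_fromCols_conjTranspose, fromRows_mul, fromRows_mul_fromCols]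
      at h
    convert h using 1
    rw [hX, conjTranspose_mul, hR.1.eq]
    simp
  · rw [trace_mul_comm, ← Matrix.mul_assoc, hUU, Matrix.one_mul, hRt]

/-- Compressing the block matrix by the column `(1; -U)` leaves a positive operator of trace `Tr P +
Tr Q - 2 Re Tr(U X)`. -/
theorem re_trace_mul_le_of_posSemidef_fromBlocks {d : Type} [Fintype d] [DecidableEq d]
    {P X Y Q : Matrix d d ℂ} (h : (fromBlocks P X Y Q).PosSemidef) {U : Matrix d d ℂ}
    (hU : U ∈ unitaryGroup d ℂ) : (U * X).trace.re ≤ (P.trace.re + Q.trace.re) / 2 := by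
  have hY : Y = Xᴴ := (isHermitian_fromBlocks_iff.mp h.1).2.1.symm
  have h2 := (h.conjTranspose_mul_mul_same (fromRows (1 : Matrix d d ℂ) (-U))).trace_nonneg
  rw [conjTranspose_fromRows_eq_fromCols_conjTranspose, fromCols_mul_fromBlocks,
    fromCols_mul_fromRows] at h2
  have h3 := (Complex.nonneg_iff.mp h2).1
  have hUU : U * Uᴴ = 1 := mem_unitaryGroup_iff.mp hU
  have e1 : (Xᴴ * Uᴴ).trace = star (U * X).trace := by
    rw [← conjTranspose_mul, trace_conjTranspose]
  have e2 : (Uᴴ * Q * U).trace = Q.trace := by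
    rw [trace_mul_comm, ← Matrix.mul_assoc, hUU, Matrix.one_mul]
  have e3 : (Uᴴ * Xᴴ).trace = (Xᴴ * Uᴴ).trace := trace_mul_comm _ _
  have e4 : (X * U).trace = (U * X).trace := trace_mul_comm _ _
  simp only [conjTranspose_one, conjTranspose_neg, Matrix.one_mul, Matrix.neg_mul, Matrix.mul_neg,
    Matrix.mul_one, Matrix.add_mul, trace_add, trace_neg, hY, e1, e2, e3, e4, neg_neg, neg_add,
    Complex.add_re, Complex.neg_re, Complex.star_def, Complex.conj_re] at h3
  linarith

theorem traceNorm_le_of_posSemidef_fromBlocks {d : Type} [Fintype d] [DecidableEq d]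
    {P X Y Q : Matrix d d ℂ} (h : (fromBlocks P X Y Q).PosSemidef) :
    traceNorm X ≤ (P.trace.re + Q.trace.re) / 2 := by
  obtain ⟨U, hU, hUX⟩ := exists_trace_unitary_mul_eq_traceNorm X
  have := re_trace_mul_le_of_posSemidef_fromBlocks h hU
  rwa [hUX, Complex.ofReal_re] at this

theorem re_trace_unitary_mul_le_traceNorm {d : Type} [Fintype d] [DecidableEq d]
    {U : Matrix d d ℂ} (hU : U ∈ unitaryGroup d ℂ) (X : Matrix d d ℂ) :
    (U * X).trace.re ≤ traceNorm X := by
  obtain ⟨P, Q, h, hP, hQ⟩ := exists_posSemidef_fromBlocks X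
  have := re_trace_mul_le_of_posSemidef_fromBlocks h hU
  rw [hP, hQ, Complex.ofReal_re] at this
  linarith

theorem traceNorm_add_le {d : Type} [Fintype d] [DecidableEq d] (X Y : Matrix d d ℂ) :
    traceNorm (X + Y) ≤ traceNorm X + traceNorm Y := by
  obtain ⟨U, hU, h⟩ := exists_trace_unitary_mul_eq_traceNorm (X + Y)
  have hX := re_trace_unitary_mul_le_traceNorm hU X
  have hY := re_trace_unitary_mul_le_traceNorm hU Y
  have := congrArg Complex.re h
  rw [Matrix.mul_add, trace_add, Complex.add_re, Complex.ofReal_re] at this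
  linarith

theorem traceNorm_unitary_mul_mul_le {d : Type} [Fintype d] [DecidableEq d] {A B : Matrix d d ℂ}
    (hA : A ∈ unitaryGroup d ℂ) (hB : B ∈ unitaryGroup d ℂ) (X : Matrix d d ℂ) :
    traceNorm (A * X * B) ≤ traceNorm X := by
  obtain ⟨U, hU, h⟩ := exists_trace_unitary_mul_eq_traceNorm (A * X * B)
  have hX := re_trace_unitary_mul_le_traceNorm (mul_mem (mul_mem hB hU) hA) X
  have e : (U * (A * X * B)).trace = (B * U * A * X).trace := by
    rw [← Matrix.mul_assoc, trace_mul_comm]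
    simp only [Matrix.mul_assoc]
  rw [← e, h, Complex.ofReal_re] at hX
  exact hX

theorem traceNorm_phase_smul_le {d : Type} [Fintype d] [DecidableEq d] {c : ℂ} (hc : ‖c‖ = 1)
    (X : Matrix d d ℂ) : traceNorm (c • X) ≤ traceNorm X := by
  have hc' : (c • (1 : Matrix d d ℂ)) ∈ unitaryGroup d ℂ := by
    rw [mem_unitaryGroup_iff, star_smul, star_one, smul_mul_smul_comm, Matrix.mul_one,
      Complex.star_def, Complex.mul_conj, Complex.normSq_eq_norm_sq, hc]
    simp
  have := traceNorm_unitary_mul_mul_le hc' (one_mem _) X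
  simpa using this

theorem traceNorm_real_smul {d : Type} [Fintype d] [DecidableEq d] {t : ℝ} (ht : 0 ≤ t)
    (X : Matrix d d ℂ) : traceNorm ((t : ℂ) • X) = t * traceNorm X := by
  apply le_antisymm
  · obtain ⟨U, hU, h⟩ := exists_trace_unitary_mul_eq_traceNorm ((t : ℂ) • X)
    have hX := re_trace_unitary_mul_le_traceNorm hU X
    have := congrArg Complex.re h
    rw [Matrix.mul_smul, trace_smul, smul_eq_mul, Complex.re_ofReal_mul, Complex.ofReal_re] at this
    rw [← this]
    gcongr
  · obtain ⟨U, hU, h⟩ := exists_trace_unitary_mul_eq_traceNorm X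
    have hX := re_trace_unitary_mul_le_traceNorm hU ((t : ℂ) • X)
    rwa [Matrix.mul_smul, trace_smul, h, smul_eq_mul, Complex.re_ofReal_mul,
      Complex.ofReal_re] at hX

theorem traceNorm_smul_le {d : Type} [Fintype d] [DecidableEq d] (c : ℂ) (X : Matrix d d ℂ) :
    traceNorm (c • X) ≤ ‖c‖ * traceNorm X := by
  rcases eq_or_ne c 0 with rfl | hc
  · have := traceNorm_real_smul le_rfl X
    simpa using this.le
  have hn : ‖c‖ ≠ 0 := norm_ne_zero_iff.mpr hc
  have e : c • X = (c / ‖c‖) • ((‖c‖ : ℝ) : ℂ) • X := by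
    rw [smul_smul, div_mul_cancel₀]
    exact_mod_cast hn
  rw [e, ← traceNorm_real_smul (norm_nonneg c)]
  refine traceNorm_phase_smul_le ?_ _
  simp [hn]

theorem eq_zero_of_traceNorm_eq_zero {d : Type} [Fintype d] [DecidableEq d] {X : Matrix d d ℂ}
    (h : traceNorm X = 0) : X = 0 := by
  obtain ⟨U, -, V, -, σ, hσ, hs, hX⟩ := exists_singularValueDecomposition X
  rw [h, Finset.sum_eq_zero_iff_of_nonneg fun i _ => hσ i] at hs
  have : (fun i => (σ i : ℂ)) = 0 := by
    ext i
    simp [hs i (Finset.mem_univ i)]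
  rw [hX, this]
  simp

theorem traceNorm_zero {d : Type} [Fintype d] [DecidableEq d] :
    traceNorm (0 : Matrix d d ℂ) = 0 := by
  have := traceNorm_real_smul (d := d) le_rfl 0
  simpa using this

theorem traceNorm_le_trace_of_posSemidef {d : Type} [Fintype d] [DecidableEq d]
    {P : Matrix d d ℂ} (h : P.PosSemidef) : traceNorm P ≤ P.trace.re := by
  have h2 := h.submatrix (Sum.elim id id : d ⊕ d → d)
  have e : P.submatrix (Sum.elim id id : d ⊕ d → d) (Sum.elim id id) = fromBlocks P P P P := by
    ext (i | i) (j | j) <;> rfl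
  rw [e] at h2
  have := traceNorm_le_of_posSemidef_fromBlocks h2
  linarith

theorem re_trace_le_traceNorm {d : Type} [Fintype d] [DecidableEq d] (X : Matrix d d ℂ) :
    X.trace.re ≤ traceNorm X := by
  simpa using re_trace_unitary_mul_le_traceNorm (one_mem _) X

end TraceNorm

/-! ### The Banach space of operators with the trace norm. -/

noncomputable section

/-- The operators on `ℂ^d` as a normed space with the trace norm. -/
def TraceClass (d : Type) : Type := Matrix d d ℂ

namespace TraceClass

variable (d : Type)

instance : AddCommGroup (TraceClass d) := inferInstanceAs (AddCommGroup (Matrix d d ℂ))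

instance : Module ℂ (TraceClass d) := inferInstanceAs (Module ℂ (Matrix d d ℂ))

instance [Fintype d] : FiniteDimensional ℂ (TraceClass d) :=
  inferInstanceAs (FiniteDimensional ℂ (Matrix d d ℂ))

-- Nontriviality gives the identity operator norm one, as the Banach algebra estimates require.
instance [Nonempty d] : Nontrivial (TraceClass d) :=
  inferInstanceAs (Nontrivial (Matrix d d ℂ))

variable [Fintype d] [DecidableEq d]

instance : NormedAddCommGroup (TraceClass d) :=
  AddGroupNorm.toNormedAddCommGroup
    { toFun := fun X => traceNorm (d := d) X
      map_zero' := traceNorm_zero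
      add_le' := traceNorm_add_le
      neg' := fun X => by
        have h : ∀ Y : Matrix d d ℂ, traceNorm (-Y) ≤ traceNorm Y := fun Y => by
          have := traceNorm_phase_smul_le (c := -1) (by simp) Y
          rwa [neg_one_smul] at this
        have h2 := h (-(show Matrix d d ℂ from X))
        rw [neg_neg] at h2
        exact le_antisymm (h X) h2
      eq_zero_of_map_eq_zero' := fun _ => eq_zero_of_traceNorm_eq_zero }

instance : NormedSpace ℂ (TraceClass d) where
  norm_smul_le c X := traceNorm_smul_le (d := d) c X

instance : CompleteSpace (TraceClass d) := FiniteDimensional.complete ℂ _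

end TraceClass

/-! ### Completely positive maps. -/

section Ampliate

open Matrix

theorem real_smul_superOp {d : Type} (t : ℝ) (Φ : SuperOp d) : t • Φ = (t : ℂ) • Φ := by
  ext1 ρ
  ext p q
  exact Complex.real_smul

theorem trace_ampliate (e : Type) {d : Type} [Fintype e] [Fintype d] (Φ : SuperOp d)
    (X : Matrix (e × d) (e × d) ℂ) :
    (ampliate e Φ X).trace = ∑ x, (Φ (X.submatrix (Prod.mk x) (Prod.mk x))).trace := by
  simp only [trace, Fintype.sum_prod_type]
  rfl

theorem trace_ampliate_of_trace_eq (e : Type) {d : Type} [Fintype e] [Fintype d] {Φ : SuperOp d}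
    {c : ℂ} (h : ∀ ρ, (Φ ρ).trace = c * ρ.trace) (X : Matrix (e × d) (e × d) ℂ) :
    (ampliate e Φ X).trace = c * X.trace := by
  simp only [trace_ampliate, h, ← Finset.mul_sum]
  simp only [trace, Fintype.sum_prod_type]
  rfl

/-- Complete positivity. -/
def IsCompletelyPositive {d : Type} (Φ : SuperOp d) : Prop :=
  ∀ (k : ℕ) (X : Matrix (Fin k × d) (Fin k × d) ℂ),
    X.PosSemidef → (ampliate (Fin k) Φ X).PosSemidef

theorem IsCompletelyPositive.posSemidef_ampliate {d : Type} {Φ : SuperOp d}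
    (h : IsCompletelyPositive Φ) {e : Type} [Fintype e] {X : Matrix (e × d) (e × d) ℂ}
    (hX : X.PosSemidef) : (ampliate e Φ X).PosSemidef := by
  let f := Fintype.equivFin e
  have h1 := (h _ _ (hX.submatrix (Prod.map f.symm id))).submatrix (Prod.map f id)
  convert h1 using 1
  ext p q
  simp [ampliate, Function.comp_def]

/-- The two blocks are absorbed into the ancilla: `(e × d) ⊕ (e × d)` is `(e ⊕ e) × d`. -/
theorem IsCompletelyPositive.posSemidef_fromBlocks {d : Type} {Φ : SuperOp d}
    (h : IsCompletelyPositive Φ) {e : Type} [Fintype e] {P X Y Q : Matrix (e × d) (e × d) ℂ}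
    (hX : (fromBlocks P X Y Q).PosSemidef) :
    (fromBlocks (ampliate e Φ P) (ampliate e Φ X) (ampliate e Φ Y)
      (ampliate e Φ Q)).PosSemidef := by
  have h1 := (h.posSemidef_ampliate (hX.submatrix (Equiv.sumProdDistrib e e d))).submatrix
    (Equiv.sumProdDistrib e e d).symm
  convert h1 using 1
  ext (i | i) (j | j) <;> rfl

/-- The dominating positive block matrix of `X` is mapped to one of the image of `X`, so growth of
the trace on positive operators bounds growth of the trace norm. -/
theorem IsCompletelyPositive.traceNorm_ampliate_le {d : Type} [Fintype d] [DecidableEq d]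
    {Φ : SuperOp d} (h : IsCompletelyPositive Φ) {e : Type} [Fintype e] [DecidableEq e] {c : ℝ}
    (hc : ∀ P : Matrix (e × d) (e × d) ℂ, P.PosSemidef →
      (ampliate e Φ P).trace.re ≤ c * P.trace.re) (X : Matrix (e × d) (e × d) ℂ) :
    traceNorm (ampliate e Φ X) ≤ c * traceNorm X := by
  obtain ⟨P, Q, hPQ, hP, hQ⟩ := exists_posSemidef_fromBlocks X
  have h1 := traceNorm_le_of_posSemidef_fromBlocks (h.posSemidef_fromBlocks hPQ)
  have h2 := hc P (hPQ.submatrix Sum.inl)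
  have h3 := hc Q (hPQ.submatrix Sum.inr)
  rw [hP, Complex.ofReal_re] at h2
  rw [hQ, Complex.ofReal_re] at h3
  linarith

theorem IsCompletelyPositive.add {d : Type} {Φ Ψ : SuperOp d} (hΦ : IsCompletelyPositive Φ)
    (hΨ : IsCompletelyPositive Ψ) : IsCompletelyPositive (Φ + Ψ) := fun k X hX =>
  (hΦ k X hX).add (hΨ k X hX)

theorem IsCompletelyPositive.zero {d : Type} : IsCompletelyPositive (0 : SuperOp d) :=
  fun _ _ _ => PosSemidef.zero

theorem IsCompletelyPositive.sum {d ι : Type} (s : Finset ι) {Φ : ι → SuperOp d}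
    (h : ∀ i, IsCompletelyPositive (Φ i)) : IsCompletelyPositive (∑ i ∈ s, Φ i) := by
  classical
  induction s using Finset.induction_on with
  | empty => simpa using IsCompletelyPositive.zero
  | insert i s hi ih =>
    rw [Finset.sum_insert hi]
    exact (h i).add ih

theorem IsCompletelyPositive.smul {d : Type} {Φ : SuperOp d} (h : IsCompletelyPositive Φ) {t : ℝ}
    (ht : 0 ≤ t) : IsCompletelyPositive (t • Φ) := fun k X hX => by
  have h1 := (h k X hX).smul (a := (t : ℂ)) (by exact_mod_cast ht)
  convert h1 using 1
  ext p q
  exact Complex.real_smul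

theorem isCompletelyPositive_conjMap {d : Type} [Fintype d] (A : Matrix d d ℂ) :
    IsCompletelyPositive (conjMap A) := fun k X hX => by
  have h1 := hX.mul_mul_conjTranspose_same (kroneckerMap (· * ·) (1 : Matrix (Fin k) (Fin k) ℂ) A)
  convert h1 using 1
  ext ⟨x, i⟩ ⟨y, j⟩
  simp [ampliate, conjMap, mul_apply, Fintype.sum_prod_type, one_apply, Finset.sum_mul, ite_mul,
    apply_ite, Finset.sum_ite_eq]

theorem isCompletelyPositive_prepareMap {d : Type} [Fintype d] {τ : Matrix d d ℂ}
    (hτ : τ.PosSemidef) : IsCompletelyPositive (prepareMap τ) := fun k X hX => by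
  have h1 : (∑ i : d, X.submatrix (fun x => (x, i)) (fun x => (x, i))).PosSemidef :=
    posSemidef_sum _ fun i _ => hX.submatrix _
  have e : ampliate (Fin k) (prepareMap τ) X = kroneckerMap (· * ·)
      (∑ i : d, X.submatrix (fun x => (x, i)) (fun x => (x, i))) τ := by
    ext ⟨x, i⟩ ⟨y, j⟩
    simp [ampliate, prepareMap, trace, Matrix.sum_apply]
  rw [e]
  exact h1.kronecker hτ

end Ampliate

/-! ### The diamond norm as an operator norm, and contraction semigroups. -/

section Amplify

open Matrix

variable {d : Type} [Fintype d] [DecidableEq d]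

/-- The map `Φ ↦ I ⊗ Φ` into the Banach algebra of bounded operators for the trace norm; it turns
the diamond norm into the operator norm. -/
def amplify (d : Type) [Fintype d] [DecidableEq d] :
    SuperOp d →ₐ[ℂ] (TraceClass (d × d) →L[ℂ] TraceClass (d × d)) :=
  AlgHom.ofLinearMap
    { toFun := fun Φ => LinearMap.toContinuousLinearMap
        (show TraceClass (d × d) →ₗ[ℂ] TraceClass (d × d) from ampliate d Φ)
      map_add' := fun _ _ => rfl
      map_smul' := fun _ _ => rfl }
    rfl (fun _ _ => rfl)

theorem norm_amplify_le {Φ : SuperOp d} {c : ℝ} (hc : 0 ≤ c)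
    (h : ∀ X, traceNorm (ampliate d Φ X) ≤ c * traceNorm X) : ‖amplify d Φ‖ ≤ c :=
  ContinuousLinearMap.opNorm_le_bound _ hc h

theorem traceNorm_ampliate_le (Φ : SuperOp d) (X : Matrix (d × d) (d × d) ℂ) :
    traceNorm (ampliate d Φ X) ≤ ‖amplify d Φ‖ * traceNorm X :=
  (amplify d Φ).le_opNorm (show TraceClass (d × d) from X)

theorem diamondNorm_eq_norm_amplify (Φ : SuperOp d) : diamondNorm Φ = ‖amplify d Φ‖ := by
  have hbound : ∀ x ∈ {x : ℝ | ∃ X : Matrix (d × d) (d × d) ℂ,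
      traceNorm X = 1 ∧ x = traceNorm (ampliate d Φ X)}, x ≤ ‖amplify d Φ‖ := by
    rintro x ⟨X, hX, rfl⟩
    simpa [hX] using traceNorm_ampliate_le Φ X
  apply le_antisymm
  · exact Real.sSup_le hbound (norm_nonneg _)
  · refine norm_amplify_le ?_ fun X => ?_
    · apply Real.sSup_nonneg
      rintro x ⟨X, -, rfl⟩
      exact traceNorm_nonneg _
    · rcases (traceNorm_nonneg X).eq_or_lt with h0 | hpos
      · have h1 := traceNorm_ampliate_le Φ X
        rw [← h0, mul_zero] at h1 ⊢
        exact h1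
      · have hle : traceNorm (ampliate d Φ ((((traceNorm X)⁻¹ : ℝ) : ℂ) • X)) ≤ diamondNorm Φ := by
          refine le_csSup ⟨_, hbound⟩ ⟨_, ?_, rfl⟩
          rw [traceNorm_real_smul (inv_nonneg.mpr hpos.le)]
          exact inv_mul_cancel₀ hpos.ne'
        rw [map_smul, traceNorm_real_smul (inv_nonneg.mpr hpos.le), inv_mul_le_iff₀ hpos] at hle
        linarith

theorem IsChannel.norm_amplify_le_one {Φ : SuperOp d} (h : IsChannel Φ) : ‖amplify d Φ‖ ≤ 1 := by
  have hcp : IsCompletelyPositive Φ := h.1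
  refine norm_amplify_le zero_le_one fun X => hcp.traceNorm_ampliate_le (fun P _ => ?_) X
  rw [trace_ampliate_of_trace_eq d (c := 1) (fun ρ => by rw [h.2, one_mul])]
  simp

/-- An algebra homomorphism on a finite-dimensional algebra is continuous, hence commutes with the
exponential series. The norm on matrices is an auxiliary choice. -/
theorem amplify_superExp (Φ : SuperOp d) :
    amplify d (superExp Φ) = NormedSpace.exp (amplify d Φ) := by
  let := Matrix.linftyOpNormedRing (n := d × d) (α := ℂ)
  let := Matrix.linftyOpNormedAlgebra (n := d × d) (α := ℂ) (R := ℂ)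
  let := NormedAlgebra.restrictScalars ℚ ℂ (Matrix (d × d) (d × d) ℂ)
  let := NormedAlgebra.restrictScalars ℚ ℂ (TraceClass (d × d) →L[ℂ] TraceClass (d × d))
  let e := LinearMap.toMatrixAlgEquiv (Matrix.stdBasis ℂ d d)
  let f := (amplify d).comp e.symm.toAlgHom
  have hf : Continuous f := f.toLinearMap.continuous_of_finiteDimensional
  have h := NormedSpace.map_exp f hf (e Φ)
  have h2 : f (e Φ) = amplify d Φ := by simp [f]
  rw [h2] at h
  rw [← h]
  rfl

theorem ampliate_mulLeft (e : Type) [Fintype e] [DecidableEq e] (A : Matrix d d ℂ)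
    (X : Matrix (e × d) (e × d) ℂ) :
    ampliate e (LinearMap.mulLeft ℂ A) X
      = kroneckerMap (· * ·) (1 : Matrix e e ℂ) A * X := by
  ext ⟨x, i⟩ ⟨y, j⟩
  simp [ampliate, mul_apply, Fintype.sum_prod_type, one_apply, ite_mul]

theorem ampliate_mulRight (e : Type) [Fintype e] [DecidableEq e] (A : Matrix d d ℂ)
    (X : Matrix (e × d) (e × d) ℂ) :
    ampliate e (LinearMap.mulRight ℂ A) X
      = X * kroneckerMap (· * ·) (1 : Matrix e e ℂ) A := by
  ext ⟨x, i⟩ ⟨y, j⟩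
  simp [ampliate, mul_apply, Fintype.sum_prod_type, one_apply, ite_mul]

theorem norm_amplify_mulLeft_le_one {U : Matrix d d ℂ} (hU : U ∈ unitaryGroup d ℂ) :
    ‖amplify d (LinearMap.mulLeft ℂ U)‖ ≤ 1 := by
  refine norm_amplify_le zero_le_one fun X => ?_
  have := traceNorm_unitary_mul_mul_le (kronecker_mem_unitary (one_mem (unitaryGroup d ℂ)) hU)
    (one_mem _) X
  rw [Matrix.mul_one] at this
  rwa [ampliate_mulLeft, one_mul]

theorem norm_amplify_mulRight_le_one {U : Matrix d d ℂ} (hU : U ∈ unitaryGroup d ℂ) :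
    ‖amplify d (LinearMap.mulRight ℂ U)‖ ≤ 1 := by
  refine norm_amplify_le zero_le_one fun X => ?_
  have := traceNorm_unitary_mul_mul_le (one_mem _)
    (kronecker_mem_unitary (one_mem (unitaryGroup d ℂ)) hU) X
  rw [Matrix.one_mul] at this
  rwa [ampliate_mulRight, one_mul]

theorem norm_amplify_mulLeft_sum_le {ι : Type} [Fintype ι] (c : ι → ℂ) {U : ι → Matrix d d ℂ}
    (hU : ∀ k, U k ∈ unitaryGroup d ℂ) :
    ‖amplify d (LinearMap.mulLeft ℂ (∑ k, c k • U k))‖ ≤ ∑ k, ‖c k‖ := by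
  have e : LinearMap.mulLeft ℂ (∑ k, c k • U k) = ∑ k, c k • LinearMap.mulLeft ℂ (U k) := by
    ext1 ρ
    simp [Finset.sum_mul, LinearMap.sum_apply]
  rw [e, map_sum]
  refine norm_sum_le_of_le _ fun k _ => ?_
  rw [map_smul, norm_smul]
  exact mul_le_of_le_one_right (norm_nonneg _) (norm_amplify_mulLeft_le_one (hU k))

theorem norm_amplify_mulRight_sum_le {ι : Type} [Fintype ι] (c : ι → ℂ) {U : ι → Matrix d d ℂ}
    (hU : ∀ k, U k ∈ unitaryGroup d ℂ) :
    ‖amplify d (LinearMap.mulRight ℂ (∑ k, c k • U k))‖ ≤ ∑ k, ‖c k‖ := by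
  have e : LinearMap.mulRight ℂ (∑ k, c k • U k) = ∑ k, c k • LinearMap.mulRight ℂ (U k) := by
    ext1 ρ
    simp [Finset.mul_sum, LinearMap.sum_apply]
  rw [e, map_sum]
  refine norm_sum_le_of_le _ fun k _ => ?_
  rw [map_smul, norm_smul]
  exact mul_le_of_le_one_right (norm_nonneg _) (norm_amplify_mulRight_le_one (hU k))

/-- A trace-annihilating generator whose Euler steps are completely positive up to a second-order
conjugation generates contractions. -/
theorem norm_exp_amplify_le_one [Nonempty d] {Λ : SuperOp d} (htr : ∀ ρ, (Λ ρ).trace = 0)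
    (G : Matrix d d ℂ)
    (hcp : ∀ t : ℝ, 0 ≤ t → IsCompletelyPositive (1 + t • Λ + t ^ 2 • conjMap G)) :
    ‖NormedSpace.exp (amplify d Λ)‖ ≤ 1 := by
  set c := ‖amplify d (conjMap G)‖
  -- One `c` comes from the trace growth of the completely positive map, the other from subtracting
  -- the conjugation again.
  refine norm_exp_le_one_of_norm_one_add_le (c := 2 * c) fun t ht _ => ?_
  have h1 : ‖amplify d (1 + t • Λ + t ^ 2 • conjMap G)‖ ≤ 1 + c * t ^ 2 := by
    refine norm_amplify_le (by positivity) fun X =>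
      (hcp t ht).traceNorm_ampliate_le (fun P hP => ?_) X
    have e : ampliate d (1 + t • Λ + t ^ 2 • conjMap G) P
        = P + t • ampliate d Λ P + t ^ 2 • ampliate d (conjMap G) P := rfl
    have e2 : (ampliate d Λ P).trace = 0 := by
      rw [trace_ampliate_of_trace_eq d (c := 0) (fun ρ => by rw [htr, zero_mul]), zero_mul]
    rw [e, trace_add, trace_add, trace_smul, trace_smul, e2, smul_zero, add_zero, Complex.add_re,
      Complex.real_smul, Complex.re_ofReal_mul]
    have h2 : (ampliate d (conjMap G) P).trace.re ≤ c * P.trace.re :=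
      (re_trace_le_traceNorm _).trans ((traceNorm_ampliate_le _ P).trans
        (mul_le_mul_of_nonneg_left (traceNorm_le_trace_of_posSemidef hP) (norm_nonneg _)))
    nlinarith [sq_nonneg t]
  have e : 1 + (t : ℂ) • amplify d Λ
      = amplify d (1 + t • Λ + t ^ 2 • conjMap G) - ((t ^ 2 : ℝ) : ℂ) • amplify d (conjMap G) := by
    rw [← map_smul, ← map_smul, ← map_one (amplify d), ← map_add, ← map_sub]
    congr 1
    rw [← real_smul_superOp, ← real_smul_superOp, add_sub_cancel_right]
  rw [e]
  refine (norm_sub_le _ _).trans ?_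
  have h3 : ‖((t ^ 2 : ℝ) : ℂ) • amplify d (conjMap G)‖ = t ^ 2 * c := by
    rw [norm_smul, Complex.norm_real, Real.norm_of_nonneg (sq_nonneg t)]
  linarith

end Amplify

end

noncomputable section

/-! ### Norm bounds and contractivity for Pauli Lindbladians. -/

section Lindbladian

open Matrix

theorem pauli_mem_unitaryGroup (i : Fin 4) : pauli i ∈ unitaryGroup (Fin 2) ℂ := by
  rw [mem_unitaryGroup_iff, star_eq_conjTranspose]
  fin_cases i <;> ext j k <;> fin_cases j <;> fin_cases k <;>
    simp [pauli, mul_apply, Fin.sum_univ_two]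

theorem pauliString_mem_unitaryGroup {n : ℕ} (P : Fin n → Fin 4) :
    pauliString P ∈ unitaryGroup (Qubits n) ℂ := by
  rw [mem_unitaryGroup_iff, star_eq_conjTranspose]
  ext x z
  have h : ∀ j, ∑ b, pauli (P j) (x j) b * star (pauli (P j) (z j) b)
      = if x j = z j then 1 else 0 := fun j => by
    have := congrFun (congrFun (mem_unitaryGroup_iff.mp (pauli_mem_unitaryGroup (P j))) (x j)) (z j)
    rwa [star_eq_conjTranspose, mul_apply, one_apply] at this
  have h2 : (pauliString P * (pauliString P)ᴴ) x z
      = ∑ y : Qubits n, ∏ j, (pauli (P j) (x j) (y j) * star (pauli (P j) (z j) (y j))) := by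
    simp [pauliString, mul_apply, Finset.prod_mul_distrib]
  -- The sum over bit strings factors into one-qubit sums, each an entry of a product `P P† = 1`.
  rw [h2, ← Fintype.prod_sum fun j b => pauli (P j) (x j) b * star (pauli (P j) (z j) b)]
  simp only [h, one_apply]
  rw [Finset.prod_ite_zero]
  simp [funext_iff]

namespace PauliSum

variable {n s : ℕ} (A : PauliSum n s)

theorem norm_coeff (k : Fin s) : ‖(A.weight k : ℂ) * A.phase k‖ = A.weight k := by
  rw [norm_mul, A.phase_norm, mul_one, Complex.norm_real, Real.norm_of_nonneg (A.weight_nonneg k)]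

theorem conjTranspose_op : A.opᴴ
    = ∑ k, star ((A.weight k : ℂ) * A.phase k) • (pauliString (A.string k))ᴴ := by
  simp only [op, conjTranspose_sum, conjTranspose_smul]

theorem norm_amplify_mulLeft_op_le :
    ‖amplify (Qubits n) (LinearMap.mulLeft ℂ A.op)‖ ≤ ∑ k, A.weight k := by
  have := norm_amplify_mulLeft_sum_le (fun k => (A.weight k : ℂ) * A.phase k)
    fun k => pauliString_mem_unitaryGroup (A.string k)
  simpa only [A.norm_coeff] using! this

theorem norm_amplify_mulRight_op_le :
    ‖amplify (Qubits n) (LinearMap.mulRight ℂ A.op)‖ ≤ ∑ k, A.weight k := by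
  have := norm_amplify_mulRight_sum_le (fun k => (A.weight k : ℂ) * A.phase k)
    fun k => pauliString_mem_unitaryGroup (A.string k)
  simpa only [A.norm_coeff] using! this

theorem norm_amplify_mulLeft_conjTranspose_op_le :
    ‖amplify (Qubits n) (LinearMap.mulLeft ℂ A.opᴴ)‖ ≤ ∑ k, A.weight k := by
  have := norm_amplify_mulLeft_sum_le (fun k => star ((A.weight k : ℂ) * A.phase k))
    fun k => Unitary.star_mem (pauliString_mem_unitaryGroup (A.string k))
  rw [conjTranspose_op]
  simpa only [norm_star, A.norm_coeff] using! this

theorem norm_amplify_mulRight_conjTranspose_op_le :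
    ‖amplify (Qubits n) (LinearMap.mulRight ℂ A.opᴴ)‖ ≤ ∑ k, A.weight k := by
  have := norm_amplify_mulRight_sum_le (fun k => star ((A.weight k : ℂ) * A.phase k))
    fun k => Unitary.star_mem (pauliString_mem_unitaryGroup (A.string k))
  rw [conjTranspose_op]
  simpa only [norm_star, A.norm_coeff] using! this

end PauliSum

namespace PauliLindbladian

variable {n m s : ℕ} (L : PauliLindbladian n m s)

theorem norm_amplify_hamiltonianPart_le :
    ‖amplify (Qubits n) L.hamiltonianPart‖ ≤ 2 * L.pauliNorm := by
  have e : L.hamiltonianPart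
      = (-Complex.I) • (LinearMap.mulLeft ℂ L.ham.op - LinearMap.mulRight ℂ L.ham.op) := rfl
  rw [e, map_smul, map_sub, norm_smul, norm_neg, Complex.norm_I, one_mul]
  have h1 := L.ham.norm_amplify_mulLeft_op_le
  have h2 := L.ham.norm_amplify_mulRight_op_le
  have h3 := norm_sub_le (amplify (Qubits n) (LinearMap.mulLeft ℂ L.ham.op))
    (amplify (Qubits n) (LinearMap.mulRight ℂ L.ham.op))
  have h4 : 0 ≤ ∑ μ, (∑ k, (L.jump μ).weight k) ^ 2 := Finset.sum_nonneg fun _ _ => sq_nonneg _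
  unfold pauliNorm
  linarith

theorem norm_amplify_dissipator_le :
    ‖amplify (Qubits n) L.dissipator‖ ≤ 2 * L.pauliNorm := by
  have e : L.dissipator = ∑ μ, (LinearMap.mulLeft ℂ (L.jump μ).op
        * LinearMap.mulRight ℂ (L.jump μ).opᴴ
      - (1 / 2 : ℂ) • (LinearMap.mulLeft ℂ (L.jump μ).opᴴ * LinearMap.mulLeft ℂ (L.jump μ).op
        + LinearMap.mulRight ℂ (L.jump μ).op * LinearMap.mulRight ℂ (L.jump μ).opᴴ)) := by
    ext1 ρ
    simp [dissipator, jumpSq, LinearMap.sum_apply, Module.End.mul_apply, Matrix.mul_assoc]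
  rw [e, map_sum]
  have h : ∀ μ ∈ Finset.univ, ‖amplify (Qubits n) (LinearMap.mulLeft ℂ (L.jump μ).op
        * LinearMap.mulRight ℂ (L.jump μ).opᴴ
      - (1 / 2 : ℂ) • (LinearMap.mulLeft ℂ (L.jump μ).opᴴ * LinearMap.mulLeft ℂ (L.jump μ).op
        + LinearMap.mulRight ℂ (L.jump μ).op * LinearMap.mulRight ℂ (L.jump μ).opᴴ))‖
      ≤ 2 * (∑ k, (L.jump μ).weight k) ^ 2 := by
    intro μ _
    set w := ∑ k, (L.jump μ).weight k
    have hw : 0 ≤ w := Finset.sum_nonneg fun k _ => (L.jump μ).weight_nonneg k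
    have h1 := (L.jump μ).norm_amplify_mulLeft_op_le
    have h2 := (L.jump μ).norm_amplify_mulRight_op_le
    have h3 := (L.jump μ).norm_amplify_mulLeft_conjTranspose_op_le
    have h4 := (L.jump μ).norm_amplify_mulRight_conjTranspose_op_le
    rw [map_sub, map_smul, map_add, map_mul, map_mul, map_mul]
    have b : ∀ {x y : TraceClass (Qubits n × Qubits n) →L[ℂ] TraceClass (Qubits n × Qubits n)},
        ‖x‖ ≤ w → ‖y‖ ≤ w → ‖x * y‖ ≤ w * w := fun hx hy =>
      (norm_mul_le _ _).trans (mul_le_mul hx hy (norm_nonneg _) hw)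
    have half : ‖(1 / 2 : ℂ)‖ = 1 / 2 := by norm_num
    refine (norm_sub_le _ _).trans ?_
    rw [norm_smul, half]
    have h5 := b h1 h4
    have h6 := (norm_add_le _ _).trans (add_le_add (b h3 h1) (b h2 h4))
    linarith
  refine (norm_sum_le_of_le _ h).trans ?_
  rw [← Finset.mul_sum]
  have h4 : 0 ≤ ∑ k, L.ham.weight k := Finset.sum_nonneg fun k _ => L.ham.weight_nonneg k
  unfold pauliNorm
  linarith

theorem pauliNorm_nonneg : 0 ≤ L.pauliNorm := by
  have := (norm_nonneg _).trans L.norm_amplify_hamiltonianPart_le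
  linarith

theorem trace_hamiltonianPart (ρ : Matrix (Qubits n) (Qubits n) ℂ) :
    (L.hamiltonianPart ρ).trace = 0 := by
  change ((-Complex.I) • (L.ham.op * ρ - ρ * L.ham.op)).trace = 0
  rw [trace_smul, trace_sub, trace_mul_comm, sub_self, smul_zero]

theorem trace_dissipator (ρ : Matrix (Qubits n) (Qubits n) ℂ) :
    (L.dissipator ρ).trace = 0 := by
  change (∑ μ, ((L.jump μ).op * ρ * (L.jump μ).opᴴ
    - (1 / 2 : ℂ) • (L.jumpSq μ * ρ + ρ * L.jumpSq μ))).trace = 0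
  rw [trace_sum]
  refine Finset.sum_eq_zero fun μ _ => ?_
  rw [trace_sub, trace_smul, trace_add, trace_mul_comm ρ, Matrix.mul_assoc, trace_mul_comm,
    Matrix.mul_assoc, trace_mul_comm ρ, jumpSq, ← two_smul ℂ, smul_smul]
  norm_num

/-- The semigroups generated by a Lindbladian and by its two parts are contractions in diamond
norm. -/
theorem norm_exp_amplify_le_one {a b : ℝ} (hb : 0 ≤ b) :
    ‖NormedSpace.exp (amplify (Qubits n) (a • L.hamiltonianPart + b • L.dissipator))‖ ≤ 1 := by
  set S : Matrix (Qubits n) (Qubits n) ℂ := ∑ μ, L.jumpSq μ with hS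
  -- `G` is the effective non-Hermitian generator. Then `(1 + tG)ρ(1 + tG)†` plus the jump terms is
  -- the Euler step plus exactly `t² GρG†`, and the left-hand side is manifestly completely
  -- positive.
  set G : Matrix (Qubits n) (Qubits n) ℂ :=
    (-(Complex.I * a)) • L.ham.op - ((b : ℂ) / 2) • S with hG
  refine _root_.norm_exp_amplify_le_one (fun ρ => ?_) G fun t ht => ?_
  · rw [LinearMap.add_apply, LinearMap.smul_apply, LinearMap.smul_apply, trace_add, trace_smul,
      trace_smul, L.trace_hamiltonianPart, L.trace_dissipator]
    simp
  · have hSH : Sᴴ = S := by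
      simp [hS, jumpSq, conjTranspose_sum, conjTranspose_mul]
    have hGH : Gᴴ = (Complex.I * a) • L.ham.op - ((b : ℂ) / 2) • S := by
      rw [hG, conjTranspose_sub, conjTranspose_smul, conjTranspose_smul, hSH, L.ham_hermitian.eq]
      simp
    have e : (1 : SuperOp (Qubits n)) + t • (a • L.hamiltonianPart + b • L.dissipator)
          + t ^ 2 • conjMap G
        = conjMap (1 + (t : ℂ) • G) + (t * b) • ∑ μ, conjMap (L.jump μ).op := by
      ext1 ρ
      have hD : L.dissipator ρ = ∑ μ, conjMap (L.jump μ).op ρ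
          - (1 / 2 : ℂ) • (S * ρ + ρ * S) := by
        rw [hS, Finset.sum_mul, Finset.mul_sum, ← Finset.sum_add_distrib, Finset.smul_sum,
          ← Finset.sum_sub_distrib]
        rfl
      have hH : L.hamiltonianPart ρ = (-Complex.I) • (L.ham.op * ρ - ρ * L.ham.op) := rfl
      have hsum : G * ρ + ρ * Gᴴ = (a : ℂ) • ((-Complex.I) • (L.ham.op * ρ - ρ * L.ham.op))
          - ((b : ℂ) / 2) • (S * ρ + ρ * S) := by
        rw [hGH, hG]
        simp only [Matrix.sub_mul, Matrix.mul_sub, Matrix.smul_mul, Matrix.mul_smul]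
        module
      have hC : conjMap (1 + (t : ℂ) • G) ρ
          = ρ + (t : ℂ) • (G * ρ + ρ * Gᴴ) + ((t : ℂ) ^ 2) • conjMap G ρ := by
        change (1 + (t : ℂ) • G) * ρ * (1 + (t : ℂ) • G)ᴴ
          = ρ + (t : ℂ) • (G * ρ + ρ * Gᴴ) + ((t : ℂ) ^ 2) • (G * ρ * Gᴴ)
        rw [conjTranspose_add, conjTranspose_one, conjTranspose_smul, Complex.star_def,
          Complex.conj_ofReal]
        simp only [Matrix.add_mul, Matrix.mul_add, Matrix.smul_mul, Matrix.mul_smul,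
          Matrix.one_mul, Matrix.mul_one]
        module
      simp only [real_smul_superOp, LinearMap.add_apply, LinearMap.smul_apply, LinearMap.sum_apply,
        Module.End.one_apply, hC, hsum, hH, hD]
      push_cast
      module
    rw [e]
    exact (isCompletelyPositive_conjMap _).add ((IsCompletelyPositive.sum _ fun μ =>
      isCompletelyPositive_conjMap _).smul (mul_nonneg ht hb))

end PauliLindbladian

end Lindbladian

/-! ### The oracles and the subroutine yield channels on the system. -/

section Channels

open Matrix

theorem StochasticChannel.isChannel_toMap {n : ℕ} (N : StochasticChannel n) :
    IsChannel N.toMap := by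
  refine ⟨?_, fun X => ?_⟩
  · have h : IsCompletelyPositive N.toMap :=
      ((IsCompletelyPositive.sum _ fun i =>
        (isCompletelyPositive_conjMap (N.U i)).smul (N.lam_nonneg i)).smul N.q_nonneg).add
      ((isCompletelyPositive_prepareMap N.state_posSemidef).smul (sub_nonneg.mpr N.q_le_one))
    exact h
  · have hU : ∀ i, (conjMap (N.U i) X).trace = X.trace := fun i => by
      have h1 : (N.U i)ᴴ * N.U i = 1 := mem_unitaryGroup_iff'.mp (N.U_unitary i)
      change (N.U i * X * (N.U i)ᴴ).trace = _
      rw [trace_mul_comm, ← Matrix.mul_assoc, h1, Matrix.one_mul]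
    have hp : (prepareMap N.state X).trace = X.trace := by
      change (X.trace • N.state).trace = _
      rw [trace_smul, N.state_trace, smul_eq_mul, mul_one]
    simp only [toMap, LinearMap.add_apply, LinearMap.smul_apply, LinearMap.sum_apply, trace_add,
      trace_smul, trace_sum, hU, hp]
    rw [← Finset.sum_smul, N.lam_sum, one_smul, ← add_smul]
    simp

theorem trace_discardAncilla (a : ℕ) {d : Type} [Fintype d]
    (X : Matrix (Qubits a × d) (Qubits a × d) ℂ) : (discardAncilla a X).trace = X.trace := by
  simp only [trace, Fintype.sum_prod_type_right]
  rfl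

theorem discardAncilla_attachAncilla (a : ℕ) {d : Type} (X : Matrix d d ℂ) :
    discardAncilla a (attachAncilla a X) = X := by
  ext i j
  simp [discardAncilla, attachAncilla]

theorem discardAncilla_ampliate (a : ℕ) {d : Type} (Φ : SuperOp d)
    (X : Matrix (Qubits a × d) (Qubits a × d) ℂ) :
    discardAncilla a (ampliate (Qubits a) Φ X) = Φ (discardAncilla a X) := by
  have e : discardAncilla a X = ∑ x, X.submatrix (Prod.mk x) (Prod.mk x) := by
    ext i j
    simp [discardAncilla, Matrix.sum_apply]
  rw [e, map_sum]
  ext i j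
  simp [discardAncilla, ampliate, Matrix.sum_apply]

theorem HamiltonianSubroutine.isChannel_toMap {n a : ℕ} (K : HamiltonianSubroutine n a) :
    IsChannel K.toMap := by
  refine ⟨fun k X hX => ?_, fun X => ?_⟩
  · let V : Matrix (Fin k × (Qubits a × Qubits n)) (Fin k × Qubits n) ℂ :=
      Matrix.of fun p q => if p.2.1 = 0 ∧ (p.1, p.2.2) = q then 1 else 0
    have h2 := K.isChannel.1 k _ (hX.mul_mul_conjTranspose_same V)
    have h3 : (∑ x : Qubits a, (ampliate (Fin k) K.joint (V * X * Vᴴ)).submatrix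
        (fun p : Fin k × Qubits n => (p.1, (x, p.2)))
        (fun p : Fin k × Qubits n => (p.1, (x, p.2)))).PosSemidef :=
      posSemidef_sum _ fun x _ => h2.submatrix _
    convert h3 using 1
    have hV : ∀ x y, (V * X * Vᴴ).submatrix (Prod.mk x) (Prod.mk y)
        = attachAncilla a (X.submatrix (Prod.mk x) (Prod.mk y)) := fun x y => by
      ext ⟨u, i⟩ ⟨v, j⟩
      by_cases hu : u = 0 <;> by_cases hv : v = 0 <;>
        simp [V, attachAncilla, mul_apply, hu, hv]
    ext ⟨x, i⟩ ⟨y, j⟩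
    simp [ampliate, HamiltonianSubroutine.toMap, discardAncilla, Matrix.sum_apply, hV]
  · change (discardAncilla a (K.joint (attachAncilla a X))).trace = _
    rw [trace_discardAncilla, K.isChannel.2, ← trace_discardAncilla, discardAncilla_attachAncilla]

end Channels

/-! ### From circuits on the register to products of maps on the system. -/

section Circuits

/-- The map on the system that an instruction implements. -/
def Instruction.systemMap {n a : ℕ} (N : StochasticChannel n) (K : HamiltonianSubroutine n a) :
    Instruction N.Label → SuperOp (Qubits n)
  | .hamiltonian => K.toMap
  | .oracle i => N.operation i

/-- The reset discards whatever the ancillas hold, and oracles ignore them, so the reduced state of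
the system evolves autonomously. -/
theorem discardAncilla_action {n a : ℕ} (N : StochasticChannel n) (K : HamiltonianSubroutine n a)
    (g : Instruction N.Label) (X : Matrix (Qubits a × Qubits n) (Qubits a × Qubits n) ℂ) :
    discardAncilla a (g.action N K X) = g.systemMap N K (discardAncilla a X) := by
  cases g with
  | hamiltonian => rfl
  | oracle i => exact discardAncilla_ampliate a _ X

theorem circuitMap_cons {n a : ℕ} (N : StochasticChannel n) (K : HamiltonianSubroutine n a)
    (g : Instruction N.Label) (c : List (Instruction N.Label)) :
    circuitMap N K (g :: c) = circuitMap N K c * g.systemMap N K := by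
  have h : ∀ (c : List (Instruction N.Label)) X Y, discardAncilla a X = discardAncilla a Y →
      discardAncilla a (circuitAction N K c X) = discardAncilla a (circuitAction N K c Y) := by
    intro c
    induction c with
    | nil => exact fun X Y h => h
    | cons g c ih =>
      intro X Y h
      exact ih _ _ (by rw [discardAncilla_action, discardAncilla_action, h])
  ext1 ρ
  refine h c _ _ ?_
  rw [discardAncilla_action, discardAncilla_attachAncilla, discardAncilla_attachAncilla]

theorem circuitMap_nil {n a : ℕ} (N : StochasticChannel n) (K : HamiltonianSubroutine n a) :
    circuitMap N K [] = 1 := by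
  ext1 ρ
  exact discardAncilla_attachAncilla a ρ

theorem circuitMap_gadget_append {n a : ℕ} (N : StochasticChannel n)
    (K : HamiltonianSubroutine n a) (i : N.Label) (c : List (Instruction N.Label)) :
    circuitMap N K (gadget i ++ c)
      = circuitMap N K c * (K.toMap * N.operation i * K.toMap) := by
  simp only [gadget, List.cons_append, List.nil_append, circuitMap_cons, Instruction.systemMap,
    mul_assoc]

theorem StochasticChannel.sum_prob_smul_operation {n : ℕ} (N : StochasticChannel n) :
    ∑ i, N.prob i • N.operation i = N.toMap := by
  rw [Fintype.sum_option]
  simp only [prob, operation, toMap, Finset.smul_sum, smul_smul]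
  rw [add_comm]

/-- By independence and multilinearity, the expected product of the gadgets is the product of the
expected gadgets. -/
theorem toMap_gadgetAlgorithm {n a : ℕ} (N : StochasticChannel n)
    (K : HamiltonianSubroutine n a) (r : ℕ) :
    (gadgetAlgorithm N r).toMap K = (K.toMap * N.toMap * K.toMap) ^ r := by
  change ∑ ω : Fin r → N.Label, (∏ j, N.prob (ω j)) •
    circuitMap N K ((List.ofFn ω).flatMap gadget) = _
  induction r with
  | zero => simp [circuitMap_nil]
  | succ r ih =>
    -- Splitting off the first label isolates the gadget executed first, which is the rightmost
    -- factor, as in `pow_succ`.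
    rw [← (Fin.consEquiv fun _ : Fin (r + 1) => N.Label).sum_comp, Fintype.sum_prod_type_right]
    have hK : K.toMap * N.toMap * K.toMap
        = ∑ i, N.prob i • (K.toMap * N.operation i * K.toMap) := by
      rw [← N.sum_prob_smul_operation, Finset.mul_sum, Finset.sum_mul]
      simp only [real_smul_superOp, mul_smul_comm, smul_mul_assoc]
    rw [pow_succ, ← ih, Finset.sum_mul]
    refine Finset.sum_congr rfl fun ω _ => ?_
    rw [hK, Finset.mul_sum]
    refine Finset.sum_congr rfl fun i _ => ?_
    simp only [Fin.consEquiv, Equiv.coe_fn_mk, Fin.prod_univ_succ, Fin.cons_zero, Fin.cons_succ,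
      List.ofFn_succ, List.flatMap_cons, circuitMap_gadget_append, real_smul_superOp]
    rw [smul_mul_smul_comm, mul_comm (N.prob i)]
    push_cast
    rfl

theorem calls_flatMap_gadget {ι : Type} (l : List ι) :
    oracleCalls (l.flatMap gadget) = l.length ∧
      hamiltonianCalls (l.flatMap gadget) = 2 * l.length := by
  induction l with
  | nil => exact ⟨rfl, rfl⟩
  | cons i l ih =>
    rw [List.flatMap_cons]
    constructor
    · rw [oracleCalls, List.countP_append, ← oracleCalls, ← oracleCalls, ih.1, List.length_cons,
        add_comm]
      rfl
    · rw [hamiltonianCalls, List.countP_append, ← hamiltonianCalls, ← hamiltonianCalls, ih.2,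
        List.length_cons, mul_add, add_comm]
      rfl

theorem calls_gadgetAlgorithm {n : ℕ} (N : StochasticChannel n) (r : ℕ)
    (ω : (gadgetAlgorithm N r).Seed) :
    oracleCalls ((gadgetAlgorithm N r).circuit ω) = r ∧
      hamiltonianCalls ((gadgetAlgorithm N r).circuit ω) = 2 * r := by
  have h := calls_flatMap_gadget (List.ofFn (show Fin r → N.Label from ω))
  rwa [List.length_ofFn] at h

end Circuits

end

/-! ### Error of one step, number of steps, and the total error. -/

section MainEstimate

/-- One step of the algorithm: the Trotter error plus the errors of the two subroutines. -/
theorem norm_exp_generator_sub_step_le {n m s : ℕ} (L : PauliLindbladian n m s) {δ c₀ η : ℝ}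
    (hδ : 0 ≤ δ) (hc₀ : 0 ≤ c₀) {Φ K : SuperOp (Qubits n)} (hΦ : IsChannel Φ) (hK : IsChannel K)
    (hN : diamondNorm (superExp (δ • L.dissipator) - Φ)
      ≤ c₀ * (diamondNorm L.dissipator * δ) ^ 3)
    (hη : diamondNorm (superExp ((δ / 2) • L.hamiltonianPart) - K) ≤ η) :
    ‖amplify (Qubits n) (superExp (δ • L.generator)) - amplify (Qubits n) (K * Φ * K)‖
      ≤ (54 + c₀) * (2 * (L.pauliNorm * δ)) ^ 3 + 2 * η := by
  have hΛ := L.pauliNorm_nonneg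
  have hu : 0 ≤ L.pauliNorm * δ := mul_nonneg hΛ hδ
  set x := amplify (Qubits n) ((δ / 2) • L.hamiltonianPart) with hx
  set y := amplify (Qubits n) (δ • L.dissipator) with hy
  have hz : amplify (Qubits n) (δ • L.generator) = (2 : ℂ) • x + y := by
    rw [hx, hy, ← map_smul, ← map_add]
    congr 1
    simp only [PauliLindbladian.generator, real_smul_superOp]
    push_cast
    module
  have hxn : ‖x‖ ≤ 2 * (L.pauliNorm * δ) := by
    rw [hx, real_smul_superOp, map_smul, norm_smul, Complex.norm_real,
      Real.norm_of_nonneg (by positivity)]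
    have := mul_le_mul_of_nonneg_left L.norm_amplify_hamiltonianPart_le (div_nonneg hδ zero_le_two)
    linarith
  have hyn : ‖y‖ ≤ 2 * (L.pauliNorm * δ) := by
    rw [hy, real_smul_superOp, map_smul, norm_smul, Complex.norm_real, Real.norm_of_nonneg hδ]
    have := mul_le_mul_of_nonneg_left L.norm_amplify_dissipator_le hδ
    linarith
  have hex : ‖NormedSpace.exp x‖ ≤ 1 := by
    have := L.norm_exp_amplify_le_one (a := δ / 2) le_rfl
    rwa [zero_smul, add_zero] at this
  have hey : ‖NormedSpace.exp y‖ ≤ 1 := by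
    have := L.norm_exp_amplify_le_one (a := 0) hδ
    rwa [zero_smul, zero_add] at this
  have hexy : ‖NormedSpace.exp ((2 : ℂ) • x + y)‖ ≤ 1 := by
    have := L.norm_exp_amplify_le_one (a := δ) hδ
    rwa [← smul_add, ← PauliLindbladian.generator, hz] at this
  have htrotter := norm_exp_sub_trotter_le hxn hyn hex hey hexy
  rw [diamondNorm_eq_norm_amplify, map_sub, amplify_superExp] at hN hη
  rw [diamondNorm_eq_norm_amplify] at hN
  have hN' : ‖NormedSpace.exp y - amplify (Qubits n) Φ‖
      ≤ c₀ * (2 * (L.pauliNorm * δ)) ^ 3 := by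
    refine hN.trans (mul_le_mul_of_nonneg_left (pow_le_pow_left₀ (by positivity) ?_ 3) hc₀)
    have := mul_le_mul_of_nonneg_right L.norm_amplify_dissipator_le hδ
    linarith
  have hprod := norm_mul_mul_sub_le (a := NormedSpace.exp x) (b := NormedSpace.exp y)
    (c := NormedSpace.exp x) (c' := amplify (Qubits n) K) hK.norm_amplify_le_one hey
    hΦ.norm_amplify_le_one hex
  have tri := norm_sub_le_norm_sub_add_norm_sub (NormedSpace.exp ((2 : ℂ) • x + y))
    (NormedSpace.exp x * NormedSpace.exp y * NormedSpace.exp x)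
    (amplify (Qubits n) K * amplify (Qubits n) Φ * amplify (Qubits n) K)
  rw [amplify_superExp, hz, map_mul, map_mul]
  linarith

theorem amplify_superExp_pow {d : Type} [Fintype d] [DecidableEq d] (Φ : SuperOp d) {T : ℝ} {r : ℕ}
    (hr : r ≠ 0) :
    amplify d (superExp (T • Φ)) = amplify d (superExp ((T / r) • Φ)) ^ r := by
  let := NormedAlgebra.restrictScalars ℚ ℂ (TraceClass (d × d) →L[ℂ] TraceClass (d × d))
  have hr' : (r : ℂ) ≠ 0 := by exact_mod_cast hr
  rw [amplify_superExp, amplify_superExp, ← NormedSpace.exp_nsmul, ← map_nsmul]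
  congr 2
  rw [real_smul_superOp, real_smul_superOp, ← Nat.cast_smul_eq_nsmul ℂ, smul_smul]
  congr 1
  push_cast
  field_simp

/-- Rounding down keeps `r₀` within the bound with no additive term; since `x < ⌊x⌋ + 1` and `r ≥
1`, the price is only a factor two. -/
theorem exists_steps {x : ℝ} :
    ∃ r₀ : ℕ, 1 ≤ r₀ ∧ (r₀ : ℝ) ≤ max 1 x ∧ ∀ r : ℕ, r₀ ≤ r → x ≤ 2 * r := by
  refine ⟨max 1 ⌊x⌋₊, le_max_left _ _, ?_, fun r hr => ?_⟩
  · rcases le_or_gt 0 x with hx | hx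
    · push_cast
      exact max_le_max le_rfl (Nat.floor_le hx)
    · simp [Nat.floor_of_nonpos hx.le]
  · have h1 : (1 : ℝ) ≤ r := by exact_mod_cast (le_max_left _ _).trans hr
    have h2 : ((⌊x⌋₊ : ℕ) : ℝ) ≤ r := by exact_mod_cast (le_max_right _ _).trans hr
    have := Nat.lt_floor_add_one x
    linarith

theorem total_error_le {c₀ ε y r : ℝ} (hc₀ : 0 ≤ c₀) (hε : 0 < ε) (hy : 0 ≤ y) (hr : 0 < r)
    (h : 60 * (Real.sqrt ((1 + 6 * c₀) / ε) * y ^ (3 / 2 : ℝ)) ≤ 2 * r) :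
    r * ((54 + c₀) * (2 * (y / r)) ^ 3 + 2 * (ε / (4 * r))) ≤ ε := by
  have hsq : (y ^ (3 / 2 : ℝ)) ^ 2 = y ^ 3 := by
    rw [← Real.rpow_natCast, ← Real.rpow_mul hy, ← Real.rpow_natCast]
    norm_num
  have h1 := pow_le_pow_left₀ (by positivity) h 2
  rw [mul_pow, mul_pow, hsq, Real.sq_sqrt (by positivity)] at h1
  have h2 : 900 * (1 + 6 * c₀) * y ^ 3 ≤ r ^ 2 * ε := by
    have h3 := mul_le_mul_of_nonneg_right h1 hε.le
    have e : 60 ^ 2 * ((1 + 6 * c₀) / ε * y ^ 3) * ε = 3600 * (1 + 6 * c₀) * y ^ 3 := by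
      field_simp
      ring
    rw [e] at h3
    linarith
  have hy3 : 0 ≤ y ^ 3 := by positivity
  -- Here `16 * 54 = 864 ≤ 900 = (60 / 2) ^ 2`: this is why 60 suffices, the halving being the loss
  -- in rounding. Half of `ε` goes to this cubic term, half to the subroutine.
  have h4 : 16 * (54 + c₀) * y ^ 3 ≤ r ^ 2 * ε := by
    nlinarith [mul_nonneg hc₀ hy3]
  have e : r * ((54 + c₀) * (2 * (y / r)) ^ 3 + 2 * (ε / (4 * r)))
      = 8 * (54 + c₀) * y ^ 3 / r ^ 2 + ε / 2 := by
    field_simp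
    ring
  have h5 : 8 * (54 + c₀) * y ^ 3 / r ^ 2 ≤ ε / 2 := by
    rw [div_le_iff₀ (by positivity)]
    linarith
  linarith

end MainEstimate

theorem theorem2 :
    ∃ C : ℝ, 0 < C ∧
      ∀ (n m s : ℕ) (L : PauliLindbladian n m s) (c₀ T ε : ℝ), 0 ≤ c₀ → 0 ≤ T → 0 < ε →
        ∃ r₀ : ℕ, 1 ≤ r₀ ∧
          (r₀ : ℝ) ≤ max 1 (C * (Real.sqrt ((1 + 6 * c₀) / ε) * (L.pauliNorm * T) ^ (3 / 2 : ℝ))) ∧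
          ∀ r : ℕ, r₀ ≤ r →
            ∀ (N : StochasticChannel n) (a : ℕ) (K : HamiltonianSubroutine n a),
              diamondNorm (superExp ((T / r) • L.dissipator) - N.toMap)
                  ≤ c₀ * (diamondNorm L.dissipator * (T / r)) ^ 3 →
              diamondNorm (superExp ((T / r / 2) • L.hamiltonianPart) - K.toMap)
                  ≤ ε / (4 * r) →
              (∀ ω, oracleCalls ((gadgetAlgorithm N r).circuit ω) = r ∧
                  hamiltonianCalls ((gadgetAlgorithm N r).circuit ω) = 2 * r) ∧
                diamondNorm (superExp (T • L.generator) - (gadgetAlgorithm N r).toMap K) ≤ ε := by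
  refine ⟨60, by norm_num, fun n m s L c₀ T ε hc₀ hT hε => ?_⟩
  obtain ⟨r₀, h1, hle, hr₀⟩ := exists_steps
    (x := 60 * (Real.sqrt ((1 + 6 * c₀) / ε) * (L.pauliNorm * T) ^ (3 / 2 : ℝ)))
  refine ⟨r₀, h1, hle, fun r hr N a K hN hK => ⟨calls_gadgetAlgorithm N r, ?_⟩⟩
  have hr1 : 0 < r := h1.trans hr
  have hr' : (0 : ℝ) < r := by exact_mod_cast hr1
  have hδ : 0 ≤ T / r := by positivity
  have hstep := norm_exp_generator_sub_step_le L hδ hc₀ N.isChannel_toMap K.isChannel_toMap hN hK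
  have hgen : ‖amplify (Qubits n) (superExp ((T / r) • L.generator))‖ ≤ 1 := by
    have := L.norm_exp_amplify_le_one (a := T / r) hδ
    rwa [← smul_add, ← PauliLindbladian.generator, ← amplify_superExp] at this
  have hsim : ‖amplify (Qubits n) (K.toMap * N.toMap * K.toMap)‖ ≤ 1 := by
    rw [map_mul, map_mul]
    refine norm_mul₃_le.trans ?_
    have hKn := K.isChannel_toMap.norm_amplify_le_one
    have hNn := N.isChannel_toMap.norm_amplify_le_one
    exact mul_le_one₀ (mul_le_one₀ hKn (norm_nonneg _) hNn) (norm_nonneg _) hKn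
  rw [diamondNorm_eq_norm_amplify, map_sub, toMap_gadgetAlgorithm, map_pow,
    amplify_superExp_pow _ hr1.ne']
  -- Contractivity of both the exact and the simulated step makes the errors add up linearly in `r`.
  refine (norm_pow_sub_pow_le_of_contraction hgen hsim r).trans ?_
  refine (mul_le_mul_of_nonneg_left hstep hr'.le).trans ?_
  rw [← mul_div_assoc]
  exact total_error_le hc₀ hε (mul_nonneg L.pauliNorm_nonneg hT) hr' (hr₀ r hr)
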